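/- Let $M\ge 2$ be an integer and $p_0,\dots,p_{M-1}\in[0,1]$ with $p_0+\dots+p_{M-1}>1$. Give every nonempty finite string $i_1\dots i_n$ of digits in $\{0,\dots,M-1\}$ a label $X_{i_1\dots i_n}\in\{0,1\}$, all labels being independent, with $\mathbb{P}(X_{i_1\dots i_n}=1)=p_{i_n}$. Let $$I_{i_1\dots i_n}=\Big[\sum_{k=1}^n \frac{i_k}{M^k},\ \sum_{k=1}^n \frac{i_k}{M^k}+\frac1{M^n}\Big],\qquad S_n=\{i_1\dots i_n:\ X_{i_1}=X_{i_1i_2}=\dots=X_{i_1\dots i_n}=1\},$$ and let $F=\bigcap_{n\ge 1}\bigcup_{i_1\dots i_n\in S_n} I_{i_1\dots i_n}$ be the random $M$-adic Cantor set so generated. Let $F_1,F_2$ be independent copies of $F$, and put $F_2-F_1=\{x_2-x_1:\ x_1\in F_1,\ x_2\in F_2\}$. For $0\le k\le M$ let $\gamma_k=\sum_{j=0}^{M-1}p_j\,p_{(j+k)\bmod M}$ be the cyclic autocorrelations (so $\gamma_M=\gamma_0$). Then, conditional on $F_1\ne\emptyset$ and $F_2\neq\emptyset$: (a) if $\gamma_k>1$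 for all $k$, then $F_2-F_1$ almost surely contains an interval of positive length; (b) if there is $k\in\{0,\dots,M-1\}$ such that $\gamma_k<1$ and $\gamma_{k+1}<1$, then almost surely $F_2-F_1$ contains no interval of positive length. -/

import Mathlib

open MeasureTheory ProbabilityTheory
open scoped unitInterval Pointwise

/-- The `M`-adic tree: its nodes are the finite strings `i₁ ⋯ iₙ` of digits in `{0, …, M - 1}`,
the root being the empty string. -/
abbrev MNode (M : ℕ) : Type := List (Fin M)

/-- Labelled `M`-adic trees: every node gets a label, `true` (for `1`) or `false` (for `0`). -/
abbrev MLabeling (M : ℕ) : Type := MNode M → Bool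

/-- The probability that a node has label `1`: it is `1` for the root and `p iₙ` for `i₁ ⋯ iₙ`. -/
def nodeProb {M : ℕ} (p : Fin M → I) (s : MNode M) : I :=
  s.getLast?.elim 1 p

/-- The law `ℙ_p` of the random labelled tree: the labels of the nodes are independent
Bernoulli variables with success probabilities `nodeProb p`. -/
noncomputable def labelLaw {M : ℕ} (p : Fin M → I) : Measure (MLabeling M) :=
  Measure.infinitePi fun s : MNode M => bernoulliMeasure true false (nodeProb p s)

/-- The left end point `i₁ / M + i₂ / M ^ 2 + ⋯ + iₙ / M ^ n`. -/
noncomputable def leftEnd {M : ℕ} (s : MNode M) : ℝ :=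
  ∑ k : Fin s.length, ((s.get k : ℕ) : ℝ) / (M : ℝ) ^ ((k : ℕ) + 1)

/-- The `n`-th level `M`-adic interval of the node `i₁ ⋯ iₙ`, of length `M ^ (-n)`. -/
noncomputable def mInterval {M : ℕ} (s : MNode M) : Set ℝ :=
  Set.Icc (leftEnd s) (leftEnd s + 1 / (M : ℝ) ^ s.length)

/-- The set `Sₙ` of the selected nodes `i₁ ⋯ iₙ` of level `n`: those with
`X (i₁) = X (i₁ i₂) = ⋯ = X (i₁ ⋯ iₙ) = 1`. -/
def selected {M : ℕ} (X : MLabeling M) (n : ℕ) : Set (MNode M) :=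
  {s | s.length = n ∧ ∀ t : MNode M, t <+: s → t ≠ [] → X t = true}

/-- The `n`-th level approximation `Fⁿ`: the union of the selected intervals of level `n`. -/
noncomputable def mCantorApprox {M : ℕ} (X : MLabeling M) (n : ℕ) : Set ℝ :=
  ⋃ s ∈ selected X n, mInterval s

/-- The `M`-adic Cantor set `F` of a labelled tree. -/
noncomputable def mCantorSet {M : ℕ} (X : MLabeling M) : Set ℝ :=
  ⋂ (n : ℕ) (_ : 1 ≤ n), mCantorApprox X n

/-- The cyclic autocorrelations `γ k = ∑ j, p j * p (j + k)`, with `j + k` taken modulo `M`. -/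
noncomputable def autocorr {M : ℕ} (p : Fin M → I) (k : ℕ) : ℝ :=
  ∑ j : Fin M, (p j : ℝ) * (p ⟨((j : ℕ) + k) % M, Nat.mod_lt _ j.pos⟩ : ℝ)

/-- The set contains a nondegenerate interval. -/
def ContainsInterval (S : Set ℝ) : Prop :=
  ∃ a b : ℝ, a < b ∧ Set.Icc a b ⊆ S

/-- The law of a pair of independent random labelled trees, conditioned on the event that
both of their Cantor sets are nonempty. -/
noncomputable def condPairLaw {M : ℕ} (p : Fin M → I) : Measure (MLabeling M × MLabeling M) :=
  ProbabilityTheory.cond ((labelLaw p).prod (labelLaw p))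
    {ω | (mCantorSet ω.1).Nonempty ∧ (mCantorSet ω.2).Nonempty}

/-! For nodes `s`, `t` of level `n` put `d = val t - val s`. The differences of points of their
intervals fill `[(d - 1) / M ^ n, (d + 1) / M ^ n]`. So an interior point of the column `[c / M ^ n,
(c + 1) / M ^ n]` is reached at level `n` only through selected pairs with difference `c` or `c +
1`. Pairs with difference `c * M + k` descend from pairs with difference `c` (digit difference `k`)
or `c + 1` (digit difference `k - M`). The two expected numbers of offspring add up to `γ k`
(`corr_succ`, `rate_add_rate`).

For (b), keep choosing the `k`-th subcolumn of a column. At both of its ends the expected number of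
pairs is multiplied by at most `max (γ k) (γ (k + 1)) < 1` per level, so almost surely both ends
become empty. There are countably many columns, and every interval contains one.

For (a), first some column is covered at all later levels with positive probability. Distinct pairs
with the same difference share no node, so their numbers of offspring are independent and
Hoeffding's bound applies. If every difference in `[0, L]` occurs `N` times, then every difference
in `[0, L * M]` occurs `A * N` times on the next level, for a fixed `A` with `1 < A < min γ`, up to
a failure probability of order `L * M * exp (-κ N)` (`pairLaw_exists_count_lt`). Along `L = M ^ i`
and `N * A ^ i` these failures sum to at most `1 / 2` once `N` is large, and such a start has
positive probability. Compactness turns a covered column into an interval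
(`Covers.containsInterval`).

Positive probability is then upgraded by Lévy's zero-one law (`ae_survival_covers`). While both
trees survive, any selected pair of level `n` carries a fresh independent copy of the whole
experiment, so the conditional probability of never covering a column stays below a constant less
than `1`. -/

open Filter Topology

namespace MAdic

variable {M : ℕ}

/-! ### Base `M` values of nodes and level `n` approximations. -/

/-- The integer with base `M` digits `s`. -/
def val : MNode M → ℤ
  | [] => 0
  | i :: s => (i : ℕ) * (M : ℤ) ^ s.length + val s

@[simp] lemma val_nil : val ([] : MNode M) = 0 := rfl

@[simp] lemma val_cons (i : Fin M) (s : MNode M) :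
    val (i :: s) = (i : ℕ) * (M : ℤ) ^ s.length + val s := rfl

lemma val_append (s u : MNode M) :
    val (s ++ u) = val s * (M : ℤ) ^ u.length + val u := by
  induction s with
  | nil => simp
  | cons i s ih =>
    simp only [List.cons_append, val_cons, ih, List.length_append, pow_add]
    ring

lemma val_concat (s : MNode M) (i : Fin M) : val (s ++ [i]) = val s * M + (i : ℕ) := by
  simp [val_append]

lemma val_nonneg (s : MNode M) : 0 ≤ val s := by
  induction s with
  | nil => simp
  | cons i s ih => rw [val_cons]; positivity

lemma val_lt (s : MNode M) : val s < (M : ℤ) ^ s.length := by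
  induction s with
  | nil => simp
  | cons i s ih =>
    rw [val_cons, List.length_cons, pow_succ']
    have h : ((i : ℕ) : ℤ) + 1 ≤ M := by exact_mod_cast i.isLt
    nlinarith [pow_nonneg (Int.natCast_nonneg M) s.length]

/-- Base `M` expansions of fixed length are unique. Hence in a pair with prescribed difference each
node determines the other, which is the source of independence in `disjoint_childIndices`. -/
lemma val_injective {s t : MNode M} (hl : s.length = t.length) (h : val s = val t) : s = t := by
  induction s generalizing t with
  | nil => exact (List.length_eq_zero_iff.1 hl.symm).symm
  | cons i s ih =>
    cases t with
    | nil => simp at hl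
    | cons j t =>
      simp only [List.length_cons, Nat.add_right_cancel_iff] at hl
      have hM : (0 : ℤ) < (M : ℤ) ^ s.length := by
        have : 0 < M := i.pos
        positivity
      simp only [val_cons, ← hl] at h
      have h1 := val_nonneg s
      have h2 := val_nonneg t
      have h3 := val_lt s
      have h4 := val_lt t
      rw [← hl] at h4
      have hij : ((i : ℕ) : ℤ) = (j : ℕ) := by
        rcases lt_trichotomy ((i : ℕ) : ℤ) (j : ℕ) with h' | h' | h'
        · nlinarith
        · exact h'
        · nlinarith
      have hij' : i = j := Fin.ext (by exact_mod_cast hij)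
      subst hij'
      rw [ih hl (by linarith)]

lemma leftEnd_eq (s : MNode M) : leftEnd s = val s / (M : ℝ) ^ s.length := by
  induction s with
  | nil => simp [leftEnd]
  | cons i s ih =>
    have hM : (M : ℝ) ≠ 0 := by exact_mod_cast i.pos.ne'
    have : leftEnd (i :: s) = (i : ℕ) / (M : ℝ) + leftEnd s / M := by
      unfold leftEnd
      rw [Finset.sum_div]
      refine (Fin.sum_univ_succ (n := s.length) _).trans ?_
      congr 1
      · simp
      · refine Finset.sum_congr rfl fun k _ => ?_
        simp only [List.get_eq_getElem, Fin.val_succ, List.getElem_cons_succ]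
        rw [div_div, ← pow_succ]
    rw [this, ih, val_cons]
    push_cast
    rw [List.length_cons]
    field_simp
    ring

lemma mem_mInterval_iff (hM : 0 < M) (s : MNode M) (x : ℝ) :
    x ∈ mInterval s ↔ val s ≤ x * (M : ℝ) ^ s.length ∧ x * (M : ℝ) ^ s.length ≤ val s + 1 := by
  have h : (0 : ℝ) < (M : ℝ) ^ s.length := by positivity
  rw [mInterval, Set.mem_Icc, leftEnd_eq, ← add_div, div_le_iff₀ h, le_div_iff₀ h]

lemma selected_concat {X : MLabeling M} {n : ℕ} {s : MNode M} {i : Fin M} :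
    s ++ [i] ∈ selected X (n + 1) ↔ s ∈ selected X n ∧ X (s ++ [i]) = true := by
  constructor
  · rintro ⟨h1, h2⟩
    refine ⟨⟨by simpa using h1, fun t ht hn => h2 t (ht.trans (List.prefix_append _ _)) hn⟩,
      h2 _ List.prefix_rfl (by simp)⟩
  · rintro ⟨⟨h1, h2⟩, h3⟩
    refine ⟨by simp [h1], fun t ht hn => ?_⟩
    rcases List.prefix_concat_iff.1 ht with rfl | h
    · exact h3
    · exact h2 t h hn

lemma selected_append {X Y : MLabeling M} {n m : ℕ} {s u : MNode M} (hs : s ∈ selected X n)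
    (hY : ∀ v ≠ [], Y v = X (s ++ v)) (hu : u ∈ selected Y m) : s ++ u ∈ selected X (n + m) := by
  refine ⟨by simp [hs.1, hu.1], fun t ht hn => ?_⟩
  rcases List.prefix_or_prefix_of_prefix ht (List.prefix_append s u) with h | ⟨r, rfl⟩
  · exact hs.2 t h hn
  · have h := (List.prefix_append_right_inj s).1 ht
    by_cases hr : r = []
    · subst hr
      exact hs.2 _ (by simp) hn
    · rw [← hY r hr]
      exact hu.2 r h hr

lemma finite_selected (X : MLabeling M) (n : ℕ) : (selected X n).Finite :=
  (List.finite_length_eq (Fin M) n).subset fun _ h => h.1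

lemma isClosed_mCantorApprox (X : MLabeling M) (n : ℕ) : IsClosed (mCantorApprox X n) :=
  (finite_selected X n).isClosed_biUnion fun _ _ => isClosed_Icc

lemma mCantorApprox_succ_subset (X : MLabeling M) (n : ℕ) :
    mCantorApprox X (n + 1) ⊆ mCantorApprox X n := by
  intro x hx
  obtain ⟨s, hs, hx⟩ := Set.mem_iUnion₂.1 hx
  obtain ⟨u, i, rfl⟩ : ∃ u i, s = u ++ [i] :=
    ⟨s.dropLast, s.getLast (by rintro rfl; simp [selected] at hs), (List.dropLast_append_getLast _).symm⟩
  have hM : 0 < M := i.pos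
  refine Set.mem_iUnion₂.2 ⟨u, (selected_concat.1 hs).1, ?_⟩
  rw [mem_mInterval_iff hM] at hx ⊢
  have hM' : (0 : ℝ) < M := by exact_mod_cast hM
  have hi : ((i : ℕ) : ℝ) + 1 ≤ M := by exact_mod_cast i.isLt
  have hi0 : (0 : ℝ) ≤ (i : ℕ) := by positivity
  rw [val_concat, List.length_append, List.length_singleton, pow_succ, ← mul_assoc] at hx
  push_cast at hx
  constructor
  · by_contra! h
    nlinarith [mul_lt_mul_of_pos_right h hM']
  · by_contra! h
    nlinarith [mul_lt_mul_of_pos_right h hM']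

lemma mCantorApprox_antitone (X : MLabeling M) : Antitone (mCantorApprox X) :=
  antitone_nat_of_succ_le (mCantorApprox_succ_subset X)

lemma leftEnd_mem_mCantorApprox {X : MLabeling M} {n : ℕ} {s : MNode M} (hs : s ∈ selected X n) :
    leftEnd s ∈ mCantorApprox X n :=
  Set.mem_iUnion₂.2 ⟨s, hs, Set.left_mem_Icc.2 (by simp)⟩

/-- Two Cantor approximations can only differ by a point of an `M`-adic column if there is a pair
of selected nodes whose difference is one of the end points of that column. -/
lemma exists_selected_of_sub_mem (hM : 0 < M) {X Y : MLabeling M} {n : ℕ} {x y : ℝ} {c : ℤ}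
    (hx : x ∈ mCantorApprox X n) (hy : y ∈ mCantorApprox Y n)
    (h1 : (c : ℝ) < (y - x) * (M : ℝ) ^ n) (h2 : (y - x) * (M : ℝ) ^ n < c + 1) :
    ∃ s ∈ selected X n, ∃ t ∈ selected Y n, val t - val s = c ∨ val t - val s = c + 1 := by
  obtain ⟨s, hs, hx⟩ := Set.mem_iUnion₂.1 hx
  obtain ⟨t, ht, hy⟩ := Set.mem_iUnion₂.1 hy
  rw [mem_mInterval_iff hM, hs.1] at hx
  rw [mem_mInterval_iff hM, ht.1] at hy
  refine ⟨s, hs, t, ht, ?_⟩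
  have h3 : ((val t - val s - 1 : ℤ) : ℝ) < (c + 1 : ℤ) := by push_cast; linarith
  have h4 : ((c : ℤ) : ℝ) < (val t - val s + 1 : ℤ) := by push_cast; linarith
  have h3' := Int.cast_lt.1 h3
  have h4' := Int.cast_lt.1 h4
  omega

/-! ### Covered columns and the intervals they produce. -/

/-- All subcolumns of the column `c` of level `n` are met by a pair of selected nodes. -/
def Covers (X Y : MLabeling M) (n : ℕ) (c : ℤ) : Prop :=
  ∀ m : ℕ, ∀ d : ℤ, c * (M : ℤ) ^ m ≤ d → d < (c + 1) * (M : ℤ) ^ m →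
    ∃ s ∈ selected X (n + m), ∃ t ∈ selected Y (n + m), val t - val s = d

lemma mem_mCantorSet_of_tendsto {X : MLabeling M} {x : ℕ → ℝ} {k : ℕ → ℕ} {a : ℝ}
    (hk : Tendsto k atTop atTop) (hx : ∀ m, x m ∈ mCantorApprox X (k m))
    (ha : Tendsto x atTop (𝓝 a)) : a ∈ mCantorSet X := by
  refine Set.mem_iInter₂.2 fun j _ => (isClosed_mCantorApprox X j).mem_of_tendsto ha ?_
  filter_upwards [hk.eventually_ge_atTop j] with m hm
  exact mCantorApprox_antitone X hm (hx m)

lemma leftEnd_mem_Icc (s : MNode M) : leftEnd s ∈ Set.Icc (0 : ℝ) 1 := by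
  have h1 := val_nonneg s
  have h2 := (val_lt s).le
  rw [leftEnd_eq]
  constructor
  · have : (0 : ℝ) ≤ val s := by exact_mod_cast h1
    positivity
  · refine div_le_one_of_le₀ (by exact_mod_cast h2) (by positivity)

/-- Given `z` in the column, some selected pair has difference `⌊z * M ^ (n + m)⌋`, so its left end
points differ by `z` up to `M ^ (-(n + m))`. A limit point of the left end points in `[0, 1]` gives
`x` and `x + z` in the two Cantor sets. -/
lemma Covers.containsInterval (hM : 2 ≤ M) {X Y : MLabeling M} {n : ℕ} {c : ℤ}
    (h : Covers X Y n c) : ContainsInterval (mCantorSet Y - mCantorSet X) := by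
  have hM0 : (0 : ℝ) < M := by positivity
  have hMn : (0 : ℝ) < (M : ℝ) ^ n := by positivity
  -- `Covers` leaves out the right end of the column. Stopping at the midpoint keeps every floor
  -- strictly below that end.
  refine ⟨c / (M : ℝ) ^ n, (c + 1 / 2) / (M : ℝ) ^ n, by gcongr; linarith, fun z hz => ?_⟩
  rw [Set.mem_Icc, div_le_iff₀ hMn, le_div_iff₀ hMn] at hz
  set d : ℕ → ℤ := fun m => ⌊z * (M : ℝ) ^ (n + m)⌋ with hd
  have key : ∀ m, ∃ s ∈ selected X (n + m), ∃ t ∈ selected Y (n + m), val t - val s = d m := by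
    intro m
    have hMm : (0 : ℝ) < (M : ℝ) ^ m := by positivity
    refine h m _ (Int.le_floor.2 ?_) (Int.floor_lt.2 ?_)
    · push_cast
      rw [pow_add, ← mul_assoc]
      exact mul_le_mul_of_nonneg_right hz.1 hMm.le
    · push_cast
      rw [pow_add, ← mul_assoc]
      exact mul_lt_mul_of_pos_right (by linarith [hz.2]) hMm
  choose s hs t ht hst using key
  obtain ⟨x, -, φ, hφ, hx⟩ := isCompact_Icc.tendsto_subseq fun m => leftEnd_mem_Icc (s m)
  have hsub : ∀ m, leftEnd (t m) = leftEnd (s m) + d m / (M : ℝ) ^ (n + m) := by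
    intro m
    rw [leftEnd_eq, leftEnd_eq, (hs m).1, (ht m).1, ← add_div, ← hst m]
    push_cast
    ring_nf
  have hpow : Tendsto (fun m : ℕ => 1 / (M : ℝ) ^ (n + m)) atTop (𝓝 0) := by
    have h1 : Tendsto (fun m : ℕ => (1 / (M : ℝ)) ^ (m + n)) atTop (𝓝 0) :=
      (tendsto_add_atTop_iff_nat n).2
        (tendsto_pow_atTop_nhds_zero_of_lt_one (by positivity)
          ((div_lt_one hM0).2 (by exact_mod_cast hM)))
    refine h1.congr fun m => ?_
    rw [div_pow, one_pow, add_comm]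
  have hlim : Tendsto (fun m => (d m : ℝ) / (M : ℝ) ^ (n + m)) atTop (𝓝 z) := by
    refine tendsto_of_tendsto_of_tendsto_of_le_of_le (g := fun m => z - 1 / (M : ℝ) ^ (n + m))
      (h := fun _ => z) (by simpa using tendsto_const_nhds.sub hpow) tendsto_const_nhds ?_ ?_
    · intro m
      have hp : (0 : ℝ) < (M : ℝ) ^ (n + m) := by positivity
      have := Int.lt_floor_add_one (z * (M : ℝ) ^ (n + m))
      show z - 1 / (M : ℝ) ^ (n + m) ≤ _
      rw [sub_le_iff_le_add, ← add_div, le_div_iff₀ hp]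
      exact this.le
    · intro m
      have hp : (0 : ℝ) < (M : ℝ) ^ (n + m) := by positivity
      show (d m : ℝ) / (M : ℝ) ^ (n + m) ≤ z
      rw [div_le_iff₀ hp]
      exact Int.floor_le _
  have hk : Tendsto (fun m => n + φ m) atTop atTop :=
    tendsto_atTop_mono (fun m => Nat.le_add_left _ _) hφ.tendsto_atTop
  refine Set.mem_sub.2 ⟨x + z, ?_, x, ?_, by ring⟩
  · refine mem_mCantorSet_of_tendsto hk (x := fun m => leftEnd (t (φ m)))
      (fun m => leftEnd_mem_mCantorApprox (ht _)) ?_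
    simp_rw [hsub]
    exact hx.add (hlim.comp hφ.tendsto_atTop)
  · exact mem_mCantorSet_of_tendsto hk (fun m => leftEnd_mem_mCantorApprox (hs _)) hx

/-- The labelling of the subtree at `s`, with the root labelled `1`. -/
def subtree (s : MNode M) (X : MLabeling M) : MLabeling M := fun u => u = [] || X (s ++ u)

lemma subtree_of_ne {s u : MNode M} (X : MLabeling M) (hu : u ≠ []) :
    subtree s X u = X (s ++ u) := by simp [subtree, hu]

/-- Columns inside the subtrees are merely translated by the difference of `s` and `t`, so any
selected pair of equal level will do. -/
lemma Covers.of_subtree {X Y : MLabeling M} {k n : ℕ} {c : ℤ} {s t : MNode M}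
    (hs : s ∈ selected X k) (ht : t ∈ selected Y k)
    (h : Covers (subtree s X) (subtree t Y) n c) :
    Covers X Y (k + n) ((val t - val s) * (M : ℤ) ^ n + c) := by
  intro m d h1 h2
  obtain ⟨u, hu, v, hv, huv⟩ := h m (d - (val t - val s) * (M : ℤ) ^ (n + m))
    (by rw [pow_add]; linarith) (by rw [pow_add]; linarith)
  refine ⟨s ++ u, ?_, t ++ v, ?_, ?_⟩
  · rw [add_assoc]
    exact selected_append hs (fun w hw => subtree_of_ne X hw) hu
  · rw [add_assoc]
    exact selected_append ht (fun w hw => subtree_of_ne Y hw) hv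
  · rw [val_append, val_append, hu.1, hv.1]
    linarith

/-! ### Counting pairs by their difference: the one-level recursion. -/

/-- The nodes of level `n`. -/
noncomputable def words (M n : ℕ) : Finset (MNode M) := (List.finite_length_eq (Fin M) n).toFinset

@[simp] lemma mem_words {n : ℕ} {s : MNode M} : s ∈ words M n ↔ s.length = n := by simp [words]

lemma sum_words_succ {β : Type*} [AddCommMonoid β] (n : ℕ) (f : MNode M → β) :
    ∑ s ∈ words M (n + 1), f s = ∑ s ∈ words M n, ∑ i : Fin M, f (s ++ [i]) := by
  rw [← Finset.sum_product']
  symm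
  refine Finset.sum_bij (fun q _ => q.1 ++ [q.2]) ?_ ?_ ?_ (fun _ _ => rfl)
  · rintro ⟨s, i⟩ h
    simpa using h
  · rintro ⟨s, i⟩ - ⟨t, j⟩ - h
    simpa using h
  · intro s hs
    have hn : s ≠ [] := by rintro rfl; simp at hs
    refine ⟨(s.dropLast, s.getLast hn), ?_, List.dropLast_append_getLast hn⟩
    simp only [mem_words] at hs
    simp [hs]

/-- The pairs of nodes of level `n` with difference `d`. -/
noncomputable def pairs (M n : ℕ) (d : ℤ) : Finset (MNode M × MNode M) :=
  (words M n ×ˢ words M n).filter fun q => val q.2 - val q.1 = d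

lemma mem_pairs {n : ℕ} {d : ℤ} {q : MNode M × MNode M} :
    q ∈ pairs M n d ↔ (q.1.length = n ∧ q.2.length = n) ∧ val q.2 - val q.1 = d := by
  simp [pairs]

/-- The pairs of digits with difference `e`. -/
def digits (M : ℕ) (e : ℤ) : Finset (Fin M × Fin M) :=
  Finset.univ.filter fun q => ((q.2 : ℕ) : ℤ) - (q.1 : ℕ) = e

lemma mem_digits {e : ℤ} {q : Fin M × Fin M} :
    q ∈ digits M e ↔ ((q.2 : ℕ) : ℤ) - (q.1 : ℕ) = e := by
  simp [digits]

/-- The weight of all pairs of nodes of level `n` with difference `d`. -/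
noncomputable def corr (f g : MNode M → ℝ) (n : ℕ) (d : ℤ) : ℝ :=
  ∑ q ∈ pairs M n d, f q.1 * g q.2

lemma corr_nonneg {f g : MNode M → ℝ} (hf : ∀ s, 0 ≤ f s) (hg : ∀ s, 0 ≤ g s) (n : ℕ) (d : ℤ) :
    0 ≤ corr f g n d :=
  Finset.sum_nonneg fun _ _ => mul_nonneg (hf _) (hg _)

/-- Digit differences lie strictly between `-M` and `M`, so the carry is `0` or `1`. The value `k =
M` is allowed so that the right end of a last subcolumn is treated like the others. -/
lemma val_sub_val_concat_eq_iff (s t : MNode M) (i j : Fin M) (c : ℤ) {k : ℕ} (hk : k ≤ M) :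
    val (t ++ [j]) - val (s ++ [i]) = c * M + k ↔
      (val t - val s = c ∧ ((j : ℕ) : ℤ) - (i : ℕ) = k) ∨
      (val t - val s = c + 1 ∧ ((j : ℕ) : ℤ) - (i : ℕ) = k - M) := by
  rw [val_concat, val_concat]
  have hi : ((i : ℕ) : ℤ) < M := by exact_mod_cast i.isLt
  have hj : ((j : ℕ) : ℤ) < M := by exact_mod_cast j.isLt
  have hi0 : (0 : ℤ) ≤ (i : ℕ) := by positivity
  have hj0 : (0 : ℤ) ≤ (j : ℕ) := by positivity
  have hk' : (k : ℤ) ≤ M := by exact_mod_cast hk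
  have hk0 : (0 : ℤ) ≤ k := by positivity
  constructor
  · intro h
    have h' : (val t - val s - c) * M = k - ((j : ℕ) - (i : ℕ) : ℤ) := by linarith
    have hM0 : (0 : ℤ) < M := by linarith
    have h1 : val t - val s - c < 2 := by
      by_contra! h1
      nlinarith
    have h2 : -1 < val t - val s - c := by
      by_contra! h2
      nlinarith
    have h3 : val t - val s - c = 0 ∨ val t - val s - c = 1 := by omega
    rcases h3 with h3 | h3 <;> rw [h3] at h'
    · left; constructor <;> linarith
    · right; constructor <;> linarith
  · rintro (⟨h1, h2⟩ | ⟨h1, h2⟩)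
    · rw [← h1, ← h2]; ring
    · have : c = val t - val s - 1 := by linarith
      rw [this]
      linarith

/-- Stated for arbitrary multiplicative weights because it is used twice: with the probabilities
`selProb` and with the random indicators `ind`. -/
lemma corr_succ {f g : MNode M → ℝ} {x y : MNode M → Fin M → ℝ}
    (hf : ∀ s i, f (s ++ [i]) = f s * x s i) (hg : ∀ s i, g (s ++ [i]) = g s * y s i)
    (n : ℕ) (c : ℤ) {k : ℕ} (hk : k ≤ M) :
    corr f g (n + 1) (c * M + k) =
      ∑ q ∈ pairs M n c, f q.1 * g q.2 * ∑ e ∈ digits M k, x q.1 e.1 * y q.2 e.2 +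
      ∑ q ∈ pairs M n (c + 1), f q.1 * g q.2 * ∑ e ∈ digits M (k - M), x q.1 e.1 * y q.2 e.2 := by
  have hdig : ∀ (e : ℤ) (s t : MNode M), ∑ r ∈ digits M e, x s r.1 * y t r.2 =
      ∑ i : Fin M, ∑ j : Fin M, if ((j : ℕ) : ℤ) - (i : ℕ) = e then x s i * y t j else 0 := by
    intro e s t
    rw [digits, Finset.sum_filter, Fintype.sum_prod_type]
  have hpair : ∀ (n : ℕ) (d : ℤ) (F : MNode M → MNode M → ℝ), ∑ q ∈ pairs M n d, F q.1 q.2 =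
      ∑ s ∈ words M n, ∑ t ∈ words M n, if val t - val s = d then F s t else 0 := by
    intro n d F
    rw [pairs, Finset.sum_filter, Finset.sum_product]
  rw [corr, hpair _ _ (fun s t => f s * g t),
    hpair _ _ (fun s t => f s * g t * ∑ e ∈ digits M k, x s e.1 * y t e.2),
    hpair _ _ (fun s t => f s * g t * ∑ e ∈ digits M (k - M), x s e.1 * y t e.2),
    sum_words_succ, ← Finset.sum_add_distrib]
  refine Finset.sum_congr rfl fun s _ => ?_
  simp_rw [sum_words_succ]
  rw [Finset.sum_comm, ← Finset.sum_add_distrib]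
  refine Finset.sum_congr rfl fun t _ => ?_
  rw [hdig, hdig]
  simp_rw [val_sub_val_concat_eq_iff s t _ _ c hk]
  rcases eq_or_ne (val t - val s) c with h | h
  · have h' : val t - val s ≠ c + 1 := by omega
    simp only [h, true_and, hf, hg, Finset.mul_sum, if_true]
    have h'' : c ≠ c + 1 := by omega
    simp only [h'', false_and, or_false, if_false, add_zero, mul_ite, mul_zero]
    refine Finset.sum_congr rfl fun i _ => Finset.sum_congr rfl fun j _ => ?_
    congr 1; ring
  · rcases eq_or_ne (val t - val s) (c + 1) with h' | h'
    · have h'' : c + 1 ≠ c := by omega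
      simp only [h', h'', true_and, false_and, false_or, hf, hg, Finset.mul_sum, if_true, if_false,
        zero_add, mul_ite, mul_zero]
      refine Finset.sum_congr rfl fun i _ => Finset.sum_congr rfl fun j _ => ?_
      congr 1; ring
    · simp [h, h']

/-- The expected number of pairs of children with difference of digits `e` of a pair of nodes. -/
noncomputable def rate (p : Fin M → I) (e : ℤ) : ℝ :=
  ∑ r ∈ digits M e, (p r.1 : ℝ) * (p r.2 : ℝ)

lemma rate_nonneg (p : Fin M → I) (e : ℤ) : 0 ≤ rate p e :=
  Finset.sum_nonneg fun r _ => mul_nonneg (p r.1).2.1 (p r.2).2.1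

/-- For each digit `i` exactly one digit `j`, namely `(i + k) % M`, has `j - i` equal to `k` or `k -
M`. -/
lemma rate_add_rate (p : Fin M → I) {k : ℕ} (hk : k ≤ M) :
    rate p k + rate p (k - M) = autocorr p k := by
  rw [rate, rate, digits, digits, Finset.sum_filter, Finset.sum_filter, Fintype.sum_prod_type,
    Fintype.sum_prod_type, ← Finset.sum_add_distrib, autocorr]
  refine Finset.sum_congr rfl fun i _ => ?_
  rw [← Finset.sum_add_distrib]
  have hM : 0 < M := i.pos
  set j₀ : Fin M := ⟨((i : ℕ) + k) % M, Nat.mod_lt _ i.pos⟩ with hj₀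
  have hi := i.isLt
  have hval : (j₀ : ℕ) = i + k ∨ (j₀ : ℕ) + M = i + k := by
    have h1 : (j₀ : ℕ) = ((i : ℕ) + k) % M := rfl
    rcases lt_or_ge ((i : ℕ) + k) M with h | h
    · left; rw [h1, Nat.mod_eq_of_lt h]
    · right
      rw [h1, Nat.mod_eq_sub_mod h, Nat.mod_eq_of_lt (by omega)]
      omega
  have hj₀' := j₀.isLt
  clear_value j₀
  dsimp only
  rw [Finset.sum_eq_single j₀]
  · rcases hval with h | h
    · rw [if_pos (by omega), if_neg (by omega), add_zero]
    · rw [if_neg (by omega), if_pos (by omega), zero_add]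
  · intro j _ hj
    have hj' : (j : ℕ) ≠ j₀ := fun h => hj (Fin.ext h)
    have := j.isLt
    rw [if_neg (by omega), if_neg (by omega), add_zero]
  · simp

/-! ### Expected numbers of pairs and their decay along subcolumns. -/

/-- The probability that a node is selected. -/
noncomputable def selProb (p : Fin M → I) (s : MNode M) : ℝ := (s.map fun i => (p i : ℝ)).prod

lemma selProb_concat (p : Fin M → I) (s : MNode M) (i : Fin M) :
    selProb p (s ++ [i]) = selProb p s * p i := by simp [selProb]

lemma selProb_nonneg (p : Fin M → I) (s : MNode M) : 0 ≤ selProb p s :=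
  List.prod_nonneg fun a ha => by
    obtain ⟨i, -, rfl⟩ := List.mem_map.1 ha
    exact (p i).2.1

lemma corr_selProb_succ (p : Fin M → I) (n : ℕ) (c : ℤ) {k : ℕ} (hk : k ≤ M) :
    corr (selProb p) (selProb p) (n + 1) (c * M + k) =
      rate p k * corr (selProb p) (selProb p) n c +
      rate p (k - M) * corr (selProb p) (selProb p) n (c + 1) := by
  rw [corr_succ (x := fun _ i => (p i : ℝ)) (y := fun _ i => (p i : ℝ)) (selProb_concat p)
    (selProb_concat p) n c hk, ← Finset.sum_mul, ← Finset.sum_mul, mul_comm, mul_comm (rate _ (_ - _))]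
  rw [rate, rate, corr, corr, mul_comm]

/-- The left end points of the subcolumns `k ⋯ k` of the column `c`. -/
def subcolumn (M k : ℕ) (c : ℤ) : ℕ → ℤ
  | 0 => c
  | m + 1 => subcolumn M k c m * M + k

/-- Both ends of the next subcolumn are fed only by the two ends of the current one, with total
rates `γ k` and `γ (k + 1)`. So the larger of the two expectations shrinks by `r` per level. -/
lemma corr_selProb_subcolumn_le (p : Fin M → I) {k : ℕ} (hk : k < M) {r : ℝ}
    (hr1 : autocorr p k ≤ r) (hr2 : autocorr p (k + 1) ≤ r) (n : ℕ) (c : ℤ) (m : ℕ) :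
    corr (selProb p) (selProb p) (n + m) (subcolumn M k c m) ≤
        r ^ m * max (corr (selProb p) (selProb p) n c) (corr (selProb p) (selProb p) n (c + 1)) ∧
      corr (selProb p) (selProb p) (n + m) (subcolumn M k c m + 1) ≤
        r ^ m * max (corr (selProb p) (selProb p) n c) (corr (selProb p) (selProb p) n (c + 1)) := by
  induction m with
  | zero => simp [subcolumn]
  | succ m ih =>
    set B := r ^ m *
      max (corr (selProb p) (selProb p) n c) (corr (selProb p) (selProb p) n (c + 1)) with hB
    have hB0 : 0 ≤ B := (corr_nonneg (selProb_nonneg p) (selProb_nonneg p) _ _).trans ih.1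
    have hpow : r ^ (m + 1) *
      max (corr (selProb p) (selProb p) n c) (corr (selProb p) (selProb p) n (c + 1)) = r * B := by
      rw [hB]; ring
    rw [hpow, ← add_assoc, subcolumn]
    have key : ∀ l : ℕ, l ≤ M → autocorr p l ≤ r →
        corr (selProb p) (selProb p) (n + m + 1) (subcolumn M k c m * M + l) ≤ r * B := by
      intro l hl hlr
      rw [corr_selProb_succ p _ _ hl]
      calc _ ≤ rate p l * B + rate p (l - M) * B := by
            gcongr
            · exact rate_nonneg _ _
            · exact ih.1
            · exact rate_nonneg _ _
            · exact ih.2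
        _ = autocorr p l * B := by rw [← add_mul, rate_add_rate p hl]
        _ ≤ r * B := by gcongr
    refine ⟨key k hk.le hr1, ?_⟩
    have := key (k + 1) hk hr2
    push_cast at this
    rwa [← add_assoc] at this

/-! ### First moment method: part (b). -/

instance (p : Fin M → I) : IsProbabilityMeasure (labelLaw p) := by
  unfold labelLaw
  infer_instance

/-- The law of a pair of independent random labelled trees. -/
noncomputable abbrev pairLaw (p : Fin M → I) : Measure (MLabeling M × MLabeling M) :=
  (labelLaw p).prod (labelLaw p)

/-- The nodes whose labels decide whether `s` is selected. -/
def ancestors (s : MNode M) : Finset (MNode M) := s.inits.toFinset.erase []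

lemma mem_ancestors {s t : MNode M} : t ∈ ancestors s ↔ t ≠ [] ∧ t <+: s := by
  simp [ancestors]

lemma mem_selected_iff {X : MLabeling M} {s : MNode M} {n : ℕ} :
    s ∈ selected X n ↔ s.length = n ∧ ∀ t ∈ ancestors s, X t = true := by
  simp only [selected, Set.mem_ofPred_eq, mem_ancestors, and_imp]
  exact and_congr_right fun _ => forall_congr' fun t => ⟨fun h a b => h b a, fun h a b => h b a⟩

lemma ancestors_concat (s : MNode M) (i : Fin M) :
    ancestors (s ++ [i]) = insert (s ++ [i]) (ancestors s) := by
  ext t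
  simp only [mem_ancestors, Finset.mem_insert, List.prefix_concat_iff]
  constructor
  · rintro ⟨h, rfl | h'⟩
    · exact Or.inl rfl
    · exact Or.inr ⟨h, h'⟩
  · rintro (rfl | ⟨h, h'⟩)
    · exact ⟨by simp, Or.inl rfl⟩
    · exact ⟨h, Or.inr h'⟩

lemma nodeProb_concat (p : Fin M → I) (s : MNode M) (i : Fin M) : nodeProb p (s ++ [i]) = p i := by
  simp [nodeProb]

lemma prod_ancestors (p : Fin M → I) (s : MNode M) :
    ∏ t ∈ ancestors s, (nodeProb p t : ℝ) = selProb p s := by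
  induction s using List.reverseRecOn with
  | nil => simp [ancestors, selProb]
  | append_singleton s i ih =>
    rw [ancestors_concat, Finset.prod_insert, ih, nodeProb_concat, selProb_concat, mul_comm]
    intro h
    have := (mem_ancestors.1 h).2.length_le
    simp at this

lemma bernoulli_true (q : I) :
    bernoulliMeasure true false q ({true} : Set Bool) = ENNReal.ofReal q := by
  rw [bernoulliMeasure_apply_of_mem_of_notMem _ (measurableSet_singleton _) (by simp) (by simp)]
  rw [ENNReal.ofReal, Real.toNNReal_of_nonneg q.2.1]
  rfl

lemma labelLaw_box (p : Fin M → I) (S : Finset (MNode M)) :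
    labelLaw p {X | ∀ t ∈ S, X t = true} = ENNReal.ofReal (∏ t ∈ S, (nodeProb p t : ℝ)) := by
  have : {X : MLabeling M | ∀ t ∈ S, X t = true} = (S : Set (MNode M)).pi fun _ => {true} := by
    ext X
    simp [Set.mem_pi]
  rw [this, labelLaw, Measure.infinitePi_pi _ (fun _ _ => measurableSet_singleton _),
    ENNReal.ofReal_prod_of_nonneg fun t _ => (nodeProb p t).2.1]
  exact Finset.prod_congr rfl fun t _ => bernoulli_true _

lemma labelLaw_selected (p : Fin M → I) {n : ℕ} {s : MNode M} (hs : s.length = n) :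
    labelLaw p {X | s ∈ selected X n} = ENNReal.ofReal (selProb p s) := by
  rw [← prod_ancestors, ← labelLaw_box]
  simp only [mem_selected_iff, hs, true_and]

/-- Some pair of selected nodes of level `n` has difference `d`. -/
def Meets (X Y : MLabeling M) (n : ℕ) (d : ℤ) : Prop :=
  ∃ s ∈ selected X n, ∃ t ∈ selected Y n, val t - val s = d

/-- Union bound over the pairs; since the trees are independent, a pair is selected with the product
of the two probabilities. -/
lemma pairLaw_meets_le (p : Fin M → I) (n : ℕ) (d : ℤ) :
    pairLaw p {ω | Meets ω.1 ω.2 n d} ≤ ENNReal.ofReal (corr (selProb p) (selProb p) n d) := by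
  have hsub : {ω : MLabeling M × MLabeling M | Meets ω.1 ω.2 n d} ⊆
      ⋃ q ∈ pairs M n d, {X | q.1 ∈ selected X n} ×ˢ {Y | q.2 ∈ selected Y n} := by
    rintro ω ⟨s, hs, t, ht, hst⟩
    exact Set.mem_iUnion₂.2 ⟨(s, t), mem_pairs.2 ⟨⟨hs.1, ht.1⟩, hst⟩, hs, ht⟩
  calc _ ≤ _ := measure_mono hsub
    _ ≤ ∑ q ∈ pairs M n d,
        pairLaw p ({X | q.1 ∈ selected X n} ×ˢ {Y | q.2 ∈ selected Y n}) :=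
      measure_biUnion_finset_le _ _
    _ = ∑ q ∈ pairs M n d, ENNReal.ofReal (selProb p q.1 * selProb p q.2) := by
      refine Finset.sum_congr rfl fun q hq => ?_
      have := (mem_pairs.1 hq).1
      rw [pairLaw, Measure.prod_prod, labelLaw_selected p this.1, labelLaw_selected p this.2,
        ENNReal.ofReal_mul (selProb_nonneg p _)]
    _ = _ := (ENNReal.ofReal_sum_of_nonneg fun q _ =>
      mul_nonneg (selProb_nonneg p _) (selProb_nonneg p _)).symm

lemma ae_exists_not_meets_subcolumn (p : Fin M → I) {k : ℕ} (hk : k < M) (h1 : autocorr p k < 1)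
    (h2 : autocorr p (k + 1) < 1) (n : ℕ) (c : ℤ) :
    ∀ᵐ ω ∂(pairLaw p), ∃ m, ¬ Meets ω.1 ω.2 (n + m) (subcolumn M k c m) ∧
      ¬ Meets ω.1 ω.2 (n + m) (subcolumn M k c m + 1) := by
  set r := max (autocorr p k) (autocorr p (k + 1)) with hr
  have hr0 : 0 ≤ r := by
    refine le_max_of_le_left ?_
    rw [← rate_add_rate p hk.le]
    exact add_nonneg (rate_nonneg _ _) (rate_nonneg _ _)
  set B := max (corr (selProb p) (selProb p) n c) (corr (selProb p) (selProb p) n (c + 1))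
  have hle : ∀ m, pairLaw p {ω | ¬ ∃ m, ¬ Meets ω.1 ω.2 (n + m) (subcolumn M k c m) ∧
      ¬ Meets ω.1 ω.2 (n + m) (subcolumn M k c m + 1)} ≤
        ENNReal.ofReal (r ^ m * B) + ENNReal.ofReal (r ^ m * B) := by
    intro m
    have hb := corr_selProb_subcolumn_le p hk (le_max_left _ _) (le_max_right _ _) n c m
    calc _ ≤ pairLaw p ({ω | Meets ω.1 ω.2 (n + m) (subcolumn M k c m)} ∪
          {ω | Meets ω.1 ω.2 (n + m) (subcolumn M k c m + 1)}) := by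
          refine measure_mono fun ω hω => ?_
          simp only [Set.mem_ofPred_eq, not_exists, not_and_or, not_not] at hω
          exact hω m
      _ ≤ _ := measure_union_le _ _
      _ ≤ _ := add_le_add
          ((pairLaw_meets_le p _ _).trans (ENNReal.ofReal_le_ofReal hb.1))
          ((pairLaw_meets_le p _ _).trans (ENNReal.ofReal_le_ofReal hb.2))
  have hlim : Tendsto (fun m : ℕ => ENNReal.ofReal (r ^ m * B) + ENNReal.ofReal (r ^ m * B)) atTop
      (𝓝 0) := by
    have h3 : Tendsto (fun m : ℕ => r ^ m * B) atTop (𝓝 0) := by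
      simpa using (tendsto_pow_atTop_nhds_zero_of_lt_one hr0 (max_lt h1 h2)).mul_const B
    have h4 := ENNReal.tendsto_ofReal h3
    simpa using h4.add h4
  exact le_antisymm (ge_of_tendsto' hlim hle) zero_le

lemma subcolumn_subset {k : ℕ} (hk : k < M) (n : ℕ) (c : ℤ) (m : ℕ) :
    (c : ℝ) / (M : ℝ) ^ n ≤ (subcolumn M k c m : ℝ) / (M : ℝ) ^ (n + m) ∧
      ((subcolumn M k c m : ℝ) + 1) / (M : ℝ) ^ (n + m) ≤ ((c : ℝ) + 1) / (M : ℝ) ^ n := by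
  have hM : (0 : ℝ) < M := by exact_mod_cast (Nat.zero_le k).trans_lt hk
  induction m with
  | zero => simp [subcolumn]
  | succ m ih =>
    have hkM : (k : ℝ) + 1 ≤ M := by exact_mod_cast hk
    have hp : (0 : ℝ) < (M : ℝ) ^ (n + m) := by positivity
    refine ⟨ih.1.trans ?_, le_trans ?_ ih.2⟩
    · rw [div_le_div_iff₀ hp (by positivity), ← add_assoc, pow_succ, subcolumn]
      push_cast
      nlinarith [mul_nonneg (Nat.cast_nonneg (α := ℝ) k) hp.le]
    · rw [div_le_div_iff₀ (by positivity) hp, ← add_assoc, pow_succ, subcolumn]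
      push_cast
      nlinarith [mul_le_mul_of_nonneg_right hkM hp.le]

/-- A column that has a subcolumn with both ends empty cannot lie in the difference set. This is
shown without conditioning and passes to the conditional law by absolute continuity. -/
theorem ae_not_containsInterval (hM : 2 ≤ M) (p : Fin M → I) {k : ℕ} (hk : k < M)
    (h1 : autocorr p k < 1) (h2 : autocorr p (k + 1) < 1) :
    ∀ᵐ ω ∂(pairLaw p), ¬ ContainsInterval (mCantorSet ω.2 - mCantorSet ω.1) := by
  have hall : ∀ᵐ ω ∂(pairLaw p), ∀ n : ℕ, ∀ c : ℤ, ∃ m,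
      ¬ Meets ω.1 ω.2 (n + m) (subcolumn M k c m) ∧
      ¬ Meets ω.1 ω.2 (n + m) (subcolumn M k c m + 1) :=
    ae_all_iff.2 fun n => ae_all_iff.2 fun c => ae_exists_not_meets_subcolumn p hk h1 h2 n c
  filter_upwards [hall] with ω hω
  rintro ⟨a, b, hab, hsub⟩
  have hM1 : (1 : ℝ) < M := by exact_mod_cast hM
  -- Two column widths fit into `[a, b]`, so the column starting at `⌈a * M ^ n⌉` lies inside it.
  obtain ⟨n, hn⟩ := ((tendsto_pow_atTop_atTop_of_one_lt hM1).eventually_gt_atTop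
    (2 / (b - a))).exists
  have hMn : (0 : ℝ) < (M : ℝ) ^ n := by positivity
  rw [div_lt_iff₀ (by linarith)] at hn
  have hc1 := Int.le_ceil (a * (M : ℝ) ^ n)
  have hc2 := Int.ceil_lt_add_one (a * (M : ℝ) ^ n)
  set c := ⌈a * (M : ℝ) ^ n⌉
  obtain ⟨m, hm1, hm2⟩ := hω n c
  obtain ⟨hs1, hs2⟩ := subcolumn_subset hk n c m
  set e := subcolumn M k c m
  have hp : (0 : ℝ) < (M : ℝ) ^ (n + m) := by positivity
  -- The midpoint is interior to the subcolumn, so only its two end differences can reach it.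
  have hz : ((e : ℝ) + 1 / 2) / (M : ℝ) ^ (n + m) ∈ mCantorSet ω.2 - mCantorSet ω.1 := by
    apply hsub
    constructor
    · calc a ≤ (c : ℝ) / (M : ℝ) ^ n := by rwa [le_div_iff₀ hMn]
        _ ≤ (e : ℝ) / (M : ℝ) ^ (n + m) := hs1
        _ ≤ _ := by gcongr; linarith
    · calc ((e : ℝ) + 1 / 2) / (M : ℝ) ^ (n + m) ≤ (e + 1) / (M : ℝ) ^ (n + m) := by
            gcongr; norm_num
        _ ≤ ((c : ℝ) + 1) / (M : ℝ) ^ n := hs2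
        _ ≤ b := by rw [div_le_iff₀ hMn]; linarith
  obtain ⟨y, hy, x, hx, hyx⟩ := Set.mem_sub.1 hz
  have hmem : ∀ {X : MLabeling M} {x : ℝ}, x ∈ mCantorSet X → x ∈ mCantorApprox X (n + m) := by
    intro X x hx
    exact mCantorApprox_antitone X (Nat.le_succ _)
      (Set.mem_iInter₂.1 hx (n + m + 1) (Nat.le_add_left _ _))
  have hyx' : (y - x) * (M : ℝ) ^ (n + m) = e + 1 / 2 := by
    rw [hyx, div_mul_cancel₀ _ hp.ne']
  obtain ⟨s, hs, t, ht, h | h⟩ := exists_selected_of_sub_mem (c := e) (by omega) (hmem hx) (hmem hy)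
    (by rw [hyx']; linarith) (by rw [hyx']; linarith)
  · exact hm1 ⟨s, hs, t, ht, h⟩
  · exact hm2 ⟨s, hs, t, ht, h⟩

/-! ### Independence of labels and σ-algebras of levels. -/

/-- A substitute for conditioning on the past `m1`: split `C` by the countably many values of `K`,
on each of which the bad event lies in a fixed future event `E k` independent of `m1`. -/
lemma measure_inter_le_of_indep {Ω κ : Type*} {m0 : MeasurableSpace Ω} {μ : Measure Ω} [Countable κ]
    {m1 m2 : MeasurableSpace Ω} (h1 : m1 ≤ m0) (h : Indep m1 m2 μ) {K : Ω → κ}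
    (hK : ∀ k, MeasurableSet[m1] (K ⁻¹' {k})) {C B : Set Ω} (hC : MeasurableSet[m1] C)
    {E : κ → Set Ω} (hE : ∀ k, MeasurableSet[m2] (E k)) {ε : ENNReal}
    (hε : ∀ ω ∈ C, μ (E (K ω)) ≤ ε) (hB : ∀ ω ∈ C, ω ∈ B → ω ∈ E (K ω)) :
    μ (C ∩ B) ≤ ε * μ C := by
  have hCu : C = ⋃ k, C ∩ K ⁻¹' {k} := by
    ext ω
    simp
  calc μ (C ∩ B) ≤ μ (⋃ k, (C ∩ K ⁻¹' {k}) ∩ E k) :=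
        measure_mono fun ω hω => Set.mem_iUnion.2 ⟨K ω, ⟨hω.1, rfl⟩, hB ω hω.1 hω.2⟩
    _ ≤ ∑' k, μ ((C ∩ K ⁻¹' {k}) ∩ E k) := measure_iUnion_le _
    _ ≤ ∑' k, ε * μ (C ∩ K ⁻¹' {k}) := by
      refine ENNReal.tsum_le_tsum fun k => ?_
      rcases (C ∩ K ⁻¹' {k}).eq_empty_or_nonempty with h0 | ⟨ω, hω, rfl⟩
      · simp [h0]
      · rw [Indep_iff _ _ _ |>.1 h _ _ (hC.inter (hK _)) (hE _), mul_comm]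
        gcongr
        exact hε ω hω
    _ = ε * ∑' k, μ (C ∩ K ⁻¹' {k}) := ENNReal.tsum_mul_left
    _ = ε * μ C := by
      rw [← measure_iUnion _ fun k => h1 _ (hC.inter (hK k)), ← hCu]
      intro j k hjk
      refine Set.disjoint_left.2 ?_
      rintro ω ⟨-, rfl⟩ ⟨-, h'⟩
      exact hjk h'

/-- The labels of a pair of trees, as one family. -/
def coord (a : MNode M ⊕ MNode M) (ω : MLabeling M × MLabeling M) : Bool :=
  Sum.elim ω.1 ω.2 a

lemma measurable_coord (a : MNode M ⊕ MNode M) : Measurable (coord a) := by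
  cases a
  · exact (measurable_pi_apply (X := fun _ : MNode M => Bool) _).comp measurable_fst
  · exact (measurable_pi_apply (X := fun _ : MNode M => Bool) _).comp measurable_snd

lemma iIndepFun_coord (p : Fin M → I) : iIndepFun (coord (M := M)) (pairLaw p) := by
  have h1 : iIndepFun (fun (s : MNode M) (X : MLabeling M) => X s) (labelLaw p) :=
    iIndepFun_infinitePi (X := fun _ x => x) fun _ => measurable_id
  rw [iIndepFun_iff_measure_inter_preimage_eq_mul] at h1 ⊢
  intro S A hA
  classical
  have hset : (⋂ a ∈ S, coord a ⁻¹' A a) =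
      (⋂ s ∈ S.toLeft, (fun X : MLabeling M => X s) ⁻¹' A (Sum.inl s)) ×ˢ
      (⋂ t ∈ S.toRight, (fun X : MLabeling M => X t) ⁻¹' A (Sum.inr t)) := by
    ext ω
    simp [coord, Set.mem_prod, Sum.forall]
  have hl : ∀ s, (pairLaw p) (coord (Sum.inl s) ⁻¹' A (Sum.inl s)) =
      labelLaw p ((fun X : MLabeling M => X s) ⁻¹' A (Sum.inl s)) := by
    intro s
    have : coord (Sum.inl s) ⁻¹' A (Sum.inl s) =
        ((fun X : MLabeling M => X s) ⁻¹' A (Sum.inl s)) ×ˢ (Set.univ : Set (MLabeling M)) := by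
      ext; simp [coord]
    rw [this, pairLaw, Measure.prod_prod, measure_univ, mul_one]
  have hr : ∀ s, (pairLaw p) (coord (Sum.inr s) ⁻¹' A (Sum.inr s)) =
      labelLaw p ((fun X : MLabeling M => X s) ⁻¹' A (Sum.inr s)) := by
    intro s
    have : coord (Sum.inr s) ⁻¹' A (Sum.inr s) = (Set.univ : Set (MLabeling M)) ×ˢ
        ((fun X : MLabeling M => X s) ⁻¹' A (Sum.inr s)) := by
      ext; simp [coord]
    rw [this, pairLaw, Measure.prod_prod, measure_univ, one_mul]
  rw [hset, pairLaw, Measure.prod_prod, h1 S.toLeft fun s hs => hA _ (Finset.mem_toLeft.1 hs),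
    h1 S.toRight fun s hs => hA _ (Finset.mem_toRight.1 hs)]
  conv_rhs => rw [← Finset.toLeft_disjSum_toRight (u := S), Finset.prod_disjSum]
  simp_rw [← hl, ← hr]

/-- The σ-algebra generated by the labels with index in `A`. -/
abbrev sigmaOf (A : Set (MNode M ⊕ MNode M)) : MeasurableSpace (MLabeling M × MLabeling M) :=
  ⨆ a ∈ A, MeasurableSpace.comap (coord a) inferInstance

lemma sigmaOf_le (A : Set (MNode M ⊕ MNode M)) : 
    sigmaOf A ≤ (inferInstance : MeasurableSpace (MLabeling M × MLabeling M)) :=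
  iSup₂_le fun a _ => (measurable_coord a).comap_le

lemma sigmaOf_mono {A B : Set (MNode M ⊕ MNode M)} (h : A ⊆ B) : sigmaOf A ≤ sigmaOf B :=
  biSup_mono h

lemma indep_sigmaOf (p : Fin M → I) {A B : Set (MNode M ⊕ MNode M)} (h : Disjoint A B) :
    Indep (sigmaOf A) (sigmaOf B) (pairLaw p) :=
  indep_iSup_of_disjoint (fun a => (measurable_coord a).comap_le) (iIndepFun_coord p) h

lemma measurable_coord_sigmaOf {A : Set (MNode M ⊕ MNode M)} {a : MNode M ⊕ MNode M}
    (ha : a ∈ A) : Measurable[sigmaOf A] (coord a) :=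
  measurable_iff_comap_le.2 (le_iSup₂_of_le a ha le_rfl)

lemma measurableSet_coord {A : Set (MNode M ⊕ MNode M)} {a : MNode M ⊕ MNode M}
    (ha : a ∈ A) : MeasurableSet[sigmaOf A] {ω | coord a ω = true} :=
  measurable_coord_sigmaOf ha (measurableSet_singleton true)

lemma sigmaOf_univ : sigmaOf Set.univ =
    (inferInstance : MeasurableSpace (MLabeling M × MLabeling M)) := by
  refine le_antisymm (sigmaOf_le _) ?_
  suffices h : Measurable[sigmaOf Set.univ] (id : MLabeling M × MLabeling M → _) by
    simpa using h.comap_le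
  refine Measurable.prodMk (m := sigmaOf Set.univ) ?_ ?_
  · exact (@measurable_pi_iff _ _ _ (sigmaOf Set.univ) _ _).2 fun s => measurable_coord_sigmaOf (a := Sum.inl s) trivial
  · exact (@measurable_pi_iff _ _ _ (sigmaOf Set.univ) _ _).2 fun s => measurable_coord_sigmaOf (a := Sum.inr s) trivial

/-- The length of a node of one of the two trees. -/
def len (a : MNode M ⊕ MNode M) : ℕ := Sum.elim List.length List.length a

lemma measurableSet_selected_fst {n : ℕ} (s : MNode M) :
    MeasurableSet[sigmaOf {a | len a ≤ n}] {ω | s ∈ selected ω.1 n} := by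
  have : {ω : MLabeling M × MLabeling M | s ∈ selected ω.1 n} =
      {ω | s.length = n ∧ ∀ t ∈ ancestors s, coord (Sum.inl t) ω = true} := by
    ext ω
    simp [mem_selected_iff, coord]
  rw [this]
  by_cases hs : s.length = n
  · have h2 : {ω : MLabeling M × MLabeling M | s.length = n ∧
        ∀ t ∈ ancestors s, coord (Sum.inl t) ω = true} =
        ⋂ t ∈ ancestors s, {ω | coord (Sum.inl t) ω = true} := by
      ext; simp [hs]
    rw [h2]
    refine Finset.measurableSet_biInter _ fun t ht => measurableSet_coord ?_
    exact (mem_ancestors.1 ht).2.length_le.trans hs.le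
  · simp [hs]

lemma measurableSet_selected_snd {n : ℕ} (s : MNode M) :
    MeasurableSet[sigmaOf {a | len a ≤ n}] {ω | s ∈ selected ω.2 n} := by
  have : {ω : MLabeling M × MLabeling M | s ∈ selected ω.2 n} =
      {ω | s.length = n ∧ ∀ t ∈ ancestors s, coord (Sum.inr t) ω = true} := by
    ext ω
    simp [mem_selected_iff, coord]
  rw [this]
  by_cases hs : s.length = n
  · have h2 : {ω : MLabeling M × MLabeling M | s.length = n ∧
        ∀ t ∈ ancestors s, coord (Sum.inr t) ω = true} =
        ⋂ t ∈ ancestors s, {ω | coord (Sum.inr t) ω = true} := by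
      ext; simp [hs]
    rw [h2]
    refine Finset.measurableSet_biInter _ fun t ht => measurableSet_coord ?_
    exact (mem_ancestors.1 ht).2.length_le.trans hs.le
  · simp [hs]

/-- The selected nodes of level `n` of both trees. -/
noncomputable def selectedPair (n : ℕ) (ω : MLabeling M × MLabeling M) :
    Finset (MNode M) × Finset (MNode M) :=
  ((finite_selected ω.1 n).toFinset, (finite_selected ω.2 n).toFinset)

lemma measurableSet_selectedPair (n : ℕ) (k : Finset (MNode M) × Finset (MNode M)) :
    MeasurableSet[sigmaOf {a | len a ≤ n}] (selectedPair n ⁻¹' {k}) := by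
  have : selectedPair n ⁻¹' {k} = (⋂ s, {ω : MLabeling M × MLabeling M | s ∈ selected ω.1 n ↔ s ∈ k.1}) ∩
      ⋂ s, {ω : MLabeling M × MLabeling M | s ∈ selected ω.2 n ↔ s ∈ k.2} := by
    ext ω
    simp [selectedPair, Prod.ext_iff, Finset.ext_iff]
  rw [this]
  refine .inter (.iInter fun s => ?_) (.iInter fun s => ?_)
  · exact (measurableSet_selected_fst s).iff (.const _)
  · exact (measurableSet_selected_snd s).iff (.const _)

lemma measurableSet_mem_selected (n : ℕ) (s : MNode M) :
    MeasurableSet {X : MLabeling M | s ∈ selected X n} := by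
  have : {X : MLabeling M | s ∈ selected X n} =
      {X | s.length = n} ∩ ⋂ t ∈ ancestors s, {X | X t = true} := by
    ext X
    simp [mem_selected_iff]
  rw [this]
  exact (MeasurableSet.const _).inter (Finset.measurableSet_biInter _ fun t _ =>
    measurable_pi_apply (X := fun _ : MNode M => Bool) t (measurableSet_singleton true))

/-- The σ-algebra on `Ω` is left free so that this also applies to subtrees and the σ-algebra of the
labels beyond level `n`. -/
lemma measurableSet_covers {Ω : Type*} {m : MeasurableSpace Ω} {X Y : Ω → MLabeling M}
    (hX : Measurable X) (hY : Measurable Y) :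
    MeasurableSet {ω | ∃ n c, Covers (X ω) (Y ω) n c} := by
  have hX' := fun n s => hX (measurableSet_mem_selected n s)
  have hY' := fun n s => hY (measurableSet_mem_selected n s)
  have : {ω | ∃ n c, Covers (X ω) (Y ω) n c} = ⋃ (n : ℕ) (c : ℤ), ⋂ (m : ℕ) (d : ℤ),
      {ω | c * (M : ℤ) ^ m ≤ d → d < (c + 1) * (M : ℤ) ^ m →
        ∃ s t : MNode M, s ∈ selected (X ω) (n + m) ∧ t ∈ selected (Y ω) (n + m) ∧
          val t - val s = d} := by
    ext ω
    simp only [Covers, Set.mem_iUnion, Set.mem_iInter, Set.mem_ofPred_eq]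
    refine exists_congr fun n => exists_congr fun c => forall_congr' fun m => forall_congr' fun d =>
      imp_congr_right fun _ => imp_congr_right fun _ => ?_
    constructor
    · rintro ⟨s, hs, t, ht, h⟩
      exact ⟨s, t, hs, ht, h⟩
    · rintro ⟨s, t, hs, ht, h⟩
      exact ⟨s, hs, t, ht, h⟩
  rw [this]
  refine .iUnion fun n => .iUnion fun c => .iInter fun m => .iInter fun d => ?_
  refine (MeasurableSet.const _).imp ((MeasurableSet.const _).imp ?_)
  have h2 : {ω | ∃ s t : MNode M, s ∈ selected (X ω) (n + m) ∧ t ∈ selected (Y ω) (n + m) ∧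
      val t - val s = d} = ⋃ (s : MNode M) (t : MNode M),
        (X ⁻¹' {X | s ∈ selected X (n + m)} ∩ (Y ⁻¹' {Y | t ∈ selected Y (n + m)} ∩
          {ω | val t - val s = d})) := by
    ext ω
    simp
  rw [h2]
  exact .iUnion fun s => .iUnion fun t => (hX' _ _).inter ((hY' _ _).inter (.const _))

/-! ### Self-similarity of the law. -/

lemma nodeProb_append (p : Fin M → I) (s : MNode M) {u : MNode M} (hu : u ≠ []) :
    nodeProb p (s ++ u) = nodeProb p u := by
  rw [nodeProb, nodeProb, List.getLast?_append_of_ne_nil _ hu]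

lemma measurable_subtree (s : MNode M) : Measurable (subtree (M := M) s) := by
  refine measurable_pi_iff.2 fun u => ?_
  by_cases hu : u = []
  · simp only [subtree, hu, decide_true, Bool.true_or]
    exact measurable_const
  · simp only [subtree, hu, decide_false, Bool.false_or]
    exact measurable_pi_apply _

/-- Below the root, the law of a label depends only on the last digit. The root label is reset to
`true` because its probability is `1`, so the law is reproduced exactly. -/
lemma labelLaw_map_subtree (p : Fin M → I) (s : MNode M) :
    (labelLaw p).map (subtree s) = labelLaw p := by
  let g : MNode M → Bool → Bool := fun u b => u = [] || b
  have hind : iIndepFun (fun (u : MNode M) (X : MLabeling M) => subtree s X u) (labelLaw p) := by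
    have h1 : iIndepFun (fun (u : MNode M) (X : MLabeling M) => X u) (labelLaw p) :=
      iIndepFun_infinitePi (X := fun _ x => x) fun _ => measurable_id
    exact (h1.precomp (g := fun u => s ++ u) (List.append_right_injective s)).comp g
      fun _ => measurable_of_countable _
  have hmeas := measurable_pi_iff.1 (measurable_subtree (M := M) s)
  have h2 := (iIndepFun_iff_map_fun_eq_infinitePi_map hmeas).1 hind
  refine h2.trans ?_
  rw [labelLaw]
  congr 1
  funext u
  by_cases hu : u = []
  · subst hu
    have : (fun X : MLabeling M => subtree s X []) = fun _ => true := by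
      funext X; simp [subtree]
    rw [this, Measure.map_const]
    simp [nodeProb]
  · have : (fun X : MLabeling M => subtree s X u) = fun X => X (s ++ u) := by
      funext X; exact subtree_of_ne X hu
    rw [this, ← nodeProb_append p s hu]
    exact Measure.infinitePi_map_eval
      (fun v : MNode M => bernoulliMeasure true false (nodeProb p v)) (s ++ u)

lemma pairLaw_subtree (p : Fin M → I) (s t : MNode M) {A : Set (MLabeling M × MLabeling M)}
    (hA : MeasurableSet A) :
    pairLaw p {ω | (subtree s ω.1, subtree t ω.2) ∈ A} = pairLaw p A := by
  have hm : Measurable (Prod.map (subtree s) (subtree t) : MLabeling M × MLabeling M → _) :=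
    (measurable_subtree s).prodMap (measurable_subtree t)
  have : (pairLaw p).map (Prod.map (subtree s) (subtree t)) = pairLaw p := by
    rw [pairLaw, ← Measure.map_prod_map _ _ (measurable_subtree s) (measurable_subtree t),
      labelLaw_map_subtree, labelLaw_map_subtree]
  conv_rhs => rw [← this, Measure.map_apply hm hA]
  rfl

lemma measurable_subtree_fst {n : ℕ} {s : MNode M} (hs : s.length = n) :
    Measurable[sigmaOf {a | n < len a}] fun ω : MLabeling M × MLabeling M => subtree s ω.1 := by
  refine (@measurable_pi_iff _ _ _ (sigmaOf _) _ _).2 fun u => ?_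
  by_cases hu : u = []
  · simp only [subtree, hu, decide_true, Bool.true_or]
    exact @measurable_const _ _ _ (sigmaOf _) _
  · simp only [subtree, hu, decide_false, Bool.false_or]
    refine measurable_coord_sigmaOf (a := Sum.inl (s ++ u)) ?_
    simp [len, hs, List.length_pos_iff, hu]

lemma measurable_subtree_snd {n : ℕ} {s : MNode M} (hs : s.length = n) :
    Measurable[sigmaOf {a | n < len a}] fun ω : MLabeling M × MLabeling M => subtree s ω.2 := by
  refine (@measurable_pi_iff _ _ _ (sigmaOf _) _ _).2 fun u => ?_
  by_cases hu : u = []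
  · simp only [subtree, hu, decide_true, Bool.true_or]
    exact @measurable_const _ _ _ (sigmaOf _) _
  · simp only [subtree, hu, decide_false, Bool.false_or]
    refine measurable_coord_sigmaOf (a := Sum.inr (s ++ u)) ?_
    simp [len, hs, List.length_pos_iff, hu]

lemma disjoint_len (n : ℕ) :
    Disjoint {a : MNode M ⊕ MNode M | len a ≤ n} {a | n < len a} :=
  Set.disjoint_left.2 fun _ h1 h2 => (lt_irrefl n) (lt_of_lt_of_le h2 h1)

/-! ### From positive probability to almost surely on survival. -/

/-- Lévy's zero-one law: an event whose conditional probabilities given a filtration stay away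
from `1` is null. -/
lemma measure_eq_zero_of_inter_le {Ω : Type*} {m0 : MeasurableSpace Ω} {μ : Measure Ω}
    [IsProbabilityMeasure μ] (ℱ : Filtration ℕ m0) {A : Set Ω} (hA : MeasurableSet[⨆ n, ℱ n] A)
    {ε : ENNReal} (hε : ε < 1)
    (h : ∀ n, ∀ B, MeasurableSet[ℱ n] B → μ (A ∩ B) ≤ ε * μ B) : μ A = 0 := by
  have hA0 : MeasurableSet A := (iSup_le fun n => ℱ.le n) _ hA
  set f : Ω → ℝ := A.indicator fun _ => 1 with hf
  have hfi : Integrable f μ := (integrable_const 1).indicator hA0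
  have hfm : StronglyMeasurable[⨆ n, ℱ n] f := stronglyMeasurable_const.indicator hA
  have hle : ∀ n, μ[f | ℱ n] ≤ᵐ[μ] fun _ => ε.toReal := by
    intro n
    refine ae_le_of_ae_le_trim (hm := ℱ.le n) ?_
    refine ae_le_of_forall_setIntegral_le
      (integrable_condExp.trim (ℱ.le n) stronglyMeasurable_condExp) (integrable_const _) ?_
    intro B hB _
    rw [← setIntegral_trim (ℱ.le n) stronglyMeasurable_condExp hB,
      setIntegral_condExp (ℱ.le n) hfi hB, setIntegral_const, hf, setIntegral_indicator hA0,
      setIntegral_const, smul_eq_mul, mul_one, smul_eq_mul, measureReal_def, measureReal_def,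
      trim_measurableSet_eq _ hB, mul_comm, ← ENNReal.toReal_mul, Set.inter_comm]
    exact ENNReal.toReal_mono (ENNReal.mul_ne_top hε.ne_top (measure_ne_top _ _)) (h n B hB)
  -- On `A` the conditional probabilities tend to `1`, although they never exceed `ε`.
  have hlim := hfi.tendsto_ae_condExp (ℱ := ℱ) hfm
  have : ∀ᵐ ω ∂μ, ω ∉ A := by
    filter_upwards [ae_all_iff.2 hle, hlim] with ω h1 h2 hω
    have h3 := le_of_tendsto' h2 h1
    rw [hf, Set.indicator_of_mem hω] at h3
    have h4 : ε.toReal < 1 := by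
      rw [← ENNReal.toReal_one]
      exact (ENNReal.toReal_lt_toReal hε.ne_top ENNReal.one_ne_top).2 hε
    linarith
  simpa [ae_iff] using this

/-- The filtration of the labels up to level `n`. -/
def levelFiltration (M : ℕ) :
    Filtration ℕ (inferInstance : MeasurableSpace (MLabeling M × MLabeling M)) where
  seq n := sigmaOf {a | len a ≤ n}
  mono' _ _ h := sigmaOf_mono fun _ ha => le_trans ha h
  le' _ := sigmaOf_le _

lemma iSup_levelFiltration :
    ⨆ n, levelFiltration M n = (inferInstance : MeasurableSpace (MLabeling M × MLabeling M)) := by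
  refine le_antisymm (iSup_le fun n => (levelFiltration M).le n) ?_
  refine sigmaOf_univ.ge.trans ?_
  refine iSup₂_le fun a _ => le_trans ?_ (le_iSup _ (len a))
  exact le_iSup₂_of_le a (le_refl (len a)) le_rfl

/-- Both trees have selected nodes on all levels. -/
def survival (M : ℕ) : Set (MLabeling M × MLabeling M) :=
  {ω | ∀ n, (selected ω.1 n).Nonempty ∧ (selected ω.2 n).Nonempty}

lemma measurableSet_nonempty (n : ℕ) :
    MeasurableSet[sigmaOf {a | len a ≤ n}] {ω : MLabeling M × MLabeling M |
      (selected ω.1 n).Nonempty ∧ (selected ω.2 n).Nonempty} := by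
  have : {ω : MLabeling M × MLabeling M | (selected ω.1 n).Nonempty ∧ (selected ω.2 n).Nonempty} =
      (⋃ s, {ω | s ∈ selected ω.1 n}) ∩ ⋃ s, {ω | s ∈ selected ω.2 n} := by
    ext ω
    simp [Set.Nonempty]
  rw [this]
  exact .inter (.iUnion fun s => measurableSet_selected_fst s)
    (.iUnion fun s => measurableSet_selected_snd s)

lemma measurableSet_survival : MeasurableSet (survival M) := by
  have : survival M = ⋂ n, {ω : MLabeling M × MLabeling M |
      (selected ω.1 n).Nonempty ∧ (selected ω.2 n).Nonempty} := by
    ext ω; simp [survival]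
  rw [this]
  exact .iInter fun n => sigmaOf_le _ _ (measurableSet_nonempty n)

/-- If a column is covered with positive probability, then some column is covered almost surely
on survival of both trees. -/
theorem ae_survival_covers (p : Fin M → I)
    (hpos : pairLaw p {ω | ∃ n c, Covers ω.1 ω.2 n c} ≠ 0) :
    ∀ᵐ ω ∂(pairLaw p).restrict (survival M), ∃ n c, Covers ω.1 ω.2 n c := by
  set G : Set (MLabeling M × MLabeling M) := {ω | ∃ n c, Covers ω.1 ω.2 n c} with hG
  have hGm : MeasurableSet G := measurableSet_covers measurable_fst measurable_snd
  rw [ae_restrict_iff' measurableSet_survival]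
  suffices h : pairLaw p (survival M ∩ Gᶜ) = 0 by
    rw [ae_iff]
    convert h using 2
    ext ω
    simp [hG]
  have hε : pairLaw p Gᶜ < 1 := by
    rw [prob_compl_eq_one_sub hGm]
    exact ENNReal.sub_lt_self ENNReal.one_ne_top one_ne_zero hpos
  refine measure_eq_zero_of_inter_le (levelFiltration M) ?_ hε fun n B hB => ?_
  · rw [iSup_levelFiltration]
    exact measurableSet_survival.inter hGm.compl
  set C := B ∩ {ω : MLabeling M × MLabeling M |
    (selected ω.1 n).Nonempty ∧ (selected ω.2 n).Nonempty}
  let P : Finset (MNode M) × Finset (MNode M) → Prop := fun k =>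
    ∃ q : MNode M × MNode M, (q.1 ∈ k.1 ∧ q.2 ∈ k.2) ∧ q.1.length = n ∧ q.2.length = n
  classical
  -- The pair is chosen as a function of the selected nodes of level `n` only. The length conditions
  -- in `P` make `E k` depend only on labels beyond level `n`.
  let E : Finset (MNode M) × Finset (MNode M) → Set (MLabeling M × MLabeling M) := fun k =>
    if h : P k then {ω | (subtree h.choose.1 ω.1, subtree h.choose.2 ω.2) ∈ Gᶜ} else ∅
  have hP : ∀ ω ∈ C, P (selectedPair n ω) := by
    rintro ω ⟨-, ⟨s, hs⟩, ⟨t, ht⟩⟩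
    exact ⟨(s, t), by simp [selectedPair, hs, ht], hs.1, ht.1⟩
  calc pairLaw p (survival M ∩ Gᶜ ∩ B) ≤ pairLaw p (C ∩ (survival M ∩ Gᶜ)) :=
        measure_mono fun ω hω => ⟨⟨hω.2, hω.1.1 n⟩, hω.1⟩
    _ ≤ pairLaw p Gᶜ * pairLaw p C := by
      refine measure_inter_le_of_indep (sigmaOf_le _) (indep_sigmaOf p (disjoint_len n))
        (measurableSet_selectedPair n) (hB.inter (measurableSet_nonempty n)) (E := E) ?_ ?_ ?_
      · intro k
        by_cases h : P k
        · simp only [E, dif_pos h]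
          have hs := h.choose_spec.2
          have := measurableSet_covers (measurable_subtree_fst hs.1) (measurable_subtree_snd hs.2)
          exact MeasurableSet.compl this
        · simp only [E, dif_neg h]
          exact @MeasurableSet.empty _ (sigmaOf _)
      · intro ω hω
        simp only [E, dif_pos (hP ω hω)]
        exact (pairLaw_subtree p _ _ hGm.compl).le
      · intro ω hω hωG
        have h := hP ω hω
        simp only [E, dif_pos h]
        rintro ⟨m, c, hc⟩
        have hc' : Covers (subtree h.choose.1 ω.1) (subtree h.choose.2 ω.2) m c := hc
        have hs := h.choose_spec.1
        exact hωG.2 ⟨_, _, hc'.of_subtree ((Set.Finite.mem_toFinset _).1 hs.1)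
          ((Set.Finite.mem_toFinset _).1 hs.2)⟩
    _ ≤ pairLaw p Gᶜ * pairLaw p B := by gcongr; exact Set.inter_subset_left

/-! ### Concentration of the number of pairs from one level to the next. -/

/-- The indicator of the selection of a node. -/
noncomputable def ind (X : MLabeling M) (s : MNode M) : ℝ :=
  if ∀ t ∈ ancestors s, X t = true then 1 else 0

/-- The label of the `i`-th child of a node, as a number. -/
def childLabel (X : MLabeling M) (s : MNode M) (i : Fin M) : ℝ := if X (s ++ [i]) = true then 1 else 0

lemma ind_nonneg (X : MLabeling M) (s : MNode M) : 0 ≤ ind X s := by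
  unfold ind; split_ifs <;> norm_num

lemma childLabel_nonneg (X : MLabeling M) (s : MNode M) (i : Fin M) : 0 ≤ childLabel X s i := by
  unfold childLabel; split_ifs <;> norm_num

lemma childLabel_le_one (X : MLabeling M) (s : MNode M) (i : Fin M) : childLabel X s i ≤ 1 := by
  unfold childLabel; split_ifs <;> norm_num

lemma ind_concat (X : MLabeling M) (s : MNode M) (i : Fin M) :
    ind X (s ++ [i]) = ind X s * childLabel X s i := by
  simp only [ind, childLabel, ancestors_concat, Finset.forall_mem_insert]
  by_cases h : X (s ++ [i]) = true <;> simp [h]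

lemma ind_eq (X : MLabeling M) {s : MNode M} {n : ℕ} (hs : s.length = n)
    [Decidable (s ∈ selected X n)] : ind X s = if s ∈ selected X n then 1 else 0 := by
  simp [ind, mem_selected_iff, hs]

/-- The number of pairs of children with difference of digits `e` of a pair of nodes. -/
def children (e : ℤ) (q : MNode M × MNode M) (ω : MLabeling M × MLabeling M) : ℝ :=
  ∑ r ∈ digits M e, childLabel ω.1 q.1 r.1 * childLabel ω.2 q.2 r.2

lemma children_nonneg (e : ℤ) (q : MNode M × MNode M) (ω : MLabeling M × MLabeling M) :
    0 ≤ children e q ω :=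
  Finset.sum_nonneg fun _ _ => mul_nonneg (childLabel_nonneg _ _ _) (childLabel_nonneg _ _ _)

lemma children_le (e : ℤ) (q : MNode M × MNode M) (ω : MLabeling M × MLabeling M) :
    children e q ω ≤ (M : ℝ) ^ 2 := by
  calc children e q ω ≤ ∑ r ∈ digits M e, (1 : ℝ) :=
        Finset.sum_le_sum fun r _ => mul_le_one₀ (childLabel_le_one _ _ _)
          (childLabel_nonneg _ _ _) (childLabel_le_one _ _ _)
    _ = ((digits M e).card : ℝ) := by simp
    _ ≤ ((Finset.univ : Finset (Fin M × Fin M)).card : ℝ) := by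
        exact_mod_cast Finset.card_le_card (Finset.filter_subset _ _)
    _ = _ := by simp [sq]

/-- The indices of the labels of the children of a pair of nodes. -/
def childIndices (q : MNode M × MNode M) : Set (MNode M ⊕ MNode M) :=
  {a | (∃ i, a = Sum.inl (q.1 ++ [i])) ∨ ∃ j, a = Sum.inr (q.2 ++ [j])}

lemma measurable_children {A : Set (MNode M ⊕ MNode M)} (e : ℤ) {q : MNode M × MNode M}
    (h : childIndices q ⊆ A) : Measurable[sigmaOf A] (children (M := M) e q) := by
  refine Finset.measurable_sum _ fun r _ => Measurable.mul ?_ ?_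
  · refine Measurable.ite (measurableSet_coord (a := Sum.inl (q.1 ++ [r.1]))
      (h (Or.inl ⟨_, rfl⟩))) ?_ ?_ <;> exact @measurable_const _ _ _ (sigmaOf A) _
  · refine Measurable.ite (measurableSet_coord (a := Sum.inr (q.2 ++ [r.2]))
      (h (Or.inr ⟨_, rfl⟩))) ?_ ?_ <;> exact @measurable_const _ _ _ (sigmaOf A) _

lemma measurable_children' (e : ℤ) (q : MNode M × MNode M) : Measurable (children (M := M) e q) :=
  (measurable_children e (Set.subset_univ _)).mono (sigmaOf_le _) le_rfl

lemma labelLaw_child (p : Fin M → I) (s : MNode M) (i : Fin M) :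
    ∫ X, childLabel X s i ∂(labelLaw p) = p i := by
  have h1 := labelLaw_box p {s ++ [i]}
  simp only [Finset.mem_singleton, forall_eq, Finset.prod_singleton, nodeProb_concat] at h1
  have h2 : (fun X : MLabeling M => childLabel X s i) =
      {X : MLabeling M | X (s ++ [i]) = true}.indicator 1 := by
    funext X
    simp [childLabel, Set.indicator]
  have h3 : MeasurableSet {X : MLabeling M | X (s ++ [i]) = true} :=
    measurable_pi_apply (X := fun _ : MNode M => Bool) _ (measurableSet_singleton true)
  rw [h2, integral_indicator_one h3, measureReal_def, h1, ENNReal.toReal_ofReal (p i).2.1]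

lemma integral_children (p : Fin M → I) (e : ℤ) (q : MNode M × MNode M) :
    ∫ ω, children e q ω ∂(pairLaw p) = rate p e := by
  have hm : ∀ (s : MNode M) (i : Fin M), Measurable fun X : MLabeling M => childLabel X s i :=
    fun s i => Measurable.ite
      (measurable_pi_apply (X := fun _ : MNode M => Bool) _ (measurableSet_singleton true))
      measurable_const measurable_const
  unfold children
  rw [integral_finsetSum]
  · refine Finset.sum_congr rfl fun r _ => ?_
    rw [pairLaw, integral_prod_mul (fun X : MLabeling M => childLabel X q.1 r.1)
      (fun Y : MLabeling M => childLabel Y q.2 r.2), labelLaw_child, labelLaw_child]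
  · intro r _
    refine Integrable.of_mem_Icc 0 1 (((hm _ _).comp measurable_fst).mul
      ((hm _ _).comp measurable_snd)).aemeasurable (ae_of_all _ fun ω => ⟨?_, ?_⟩)
    · exact mul_nonneg (childLabel_nonneg _ _ _) (childLabel_nonneg _ _ _)
    · exact mul_le_one₀ (childLabel_le_one _ _ _) (childLabel_nonneg _ _ _) (childLabel_le_one _ _ _)

/-- The sub-Gaussian parameter of the number of pairs of children of a pair of nodes. -/
noncomputable def variance (M : ℕ) : NNReal := (‖(M : ℝ) ^ 2 - 0‖₊ / 2) ^ 2

lemma variance_pos (hM : 0 < M) : 0 < variance M := by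
  have : (M : ℝ) ^ 2 - 0 ≠ 0 := by
    have : (0 : ℝ) < M := by exact_mod_cast hM
    rw [sub_zero]; positivity
  have h2 : 0 < ‖(M : ℝ) ^ 2 - 0‖₊ := nnnorm_pos.2 this
  unfold variance
  positivity

/-- With a common difference, sharing one node would force the pairs to be equal; so distinct pairs
use disjoint sets of child labels. -/
lemma disjoint_childIndices {n : ℕ} {d : ℤ} {q q' : MNode M × MNode M} (hq : q ∈ pairs M n d)
    (hq' : q' ∈ pairs M n d) (h : q ≠ q') : Disjoint (childIndices q) (childIndices q') := by
  rw [mem_pairs] at hq hq'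
  refine Set.disjoint_left.2 fun a ha ha' => h ?_
  rcases ha with ⟨i, rfl⟩ | ⟨i, rfl⟩ <;> rcases ha' with ⟨j, hj⟩ | ⟨j, hj⟩
  · have h1 : q.1 = q'.1 := (List.append_inj' (Sum.inl.inj hj) rfl).1
    refine Prod.ext h1 (val_injective (hq.1.2.trans hq'.1.2.symm) ?_)
    have := hq.2.trans hq'.2.symm
    rw [h1] at this
    linarith
  · cases hj
  · cases hj
  · have h1 : q.2 = q'.2 := (List.append_inj' (Sum.inr.inj hj) rfl).1
    refine Prod.ext (val_injective (hq.1.1.trans hq'.1.1.symm) ?_) h1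
    have := hq.2.trans hq'.2.symm
    rw [h1] at this
    linarith

/-- Hoeffding's lemma for variables with values in `[0, M ^ 2]`, added up over pairs with disjoint
child labels. -/
lemma hasSubgaussianMGF_sum_children (p : Fin M → I) (e : ℤ) {n : ℕ} {d : ℤ}
    (P : Finset (MNode M × MNode M)) (hP : P ⊆ pairs M n d) :
    HasSubgaussianMGF (fun ω => ∑ q ∈ P, (children e q ω - rate p e)) (P.card * variance M)
      (pairLaw p) := by
  classical
  induction P using Finset.induction_on with
  | empty => simp
  | insert q P hq ih =>
    have hqn := hP (Finset.mem_insert_self q P)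
    have hPn := (Finset.subset_insert q P).trans hP
    simp_rw [Finset.sum_insert hq]
    rw [Finset.card_insert_of_notMem hq, Nat.cast_add, Nat.cast_one, add_comm, add_mul, one_mul]
    refine HasSubgaussianMGF.add_of_indepFun ?_ (ih hPn) ?_
    · have := hasSubgaussianMGF_of_mem_Icc (μ := pairLaw p) (a := 0) (b := (M : ℝ) ^ 2)
        (measurable_children' e q).aemeasurable
        (ae_of_all _ fun ω => ⟨children_nonneg e q ω, children_le e q ω⟩)
      rwa [integral_children] at this
    · have hdis : Disjoint (childIndices q) (⋃ q' ∈ P, childIndices q') := by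
        simp only [Set.disjoint_iUnion_right]
        exact fun q' hq' => disjoint_childIndices hqn (hPn hq') (by rintro rfl; exact hq hq')
      refine (IndepFun_iff_Indep _ _ _).2 (indep_of_indep_of_le_left
        (indep_of_indep_of_le_right (indep_sigmaOf p hdis) ?_) ?_)
      · refine Measurable.comap_le ?_
        refine Finset.measurable_sum _ fun q' hq' => Measurable.sub ?_ ?_
        · exact measurable_children e (Set.subset_biUnion_of_mem (u := childIndices) hq')
        · exact @measurable_const _ _ _ (sigmaOf _) _
      · refine Measurable.comap_le (Measurable.sub (measurable_children e subset_rfl) ?_)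
        exact @measurable_const _ _ _ (sigmaOf _) _

/-- Large deviations of the number of pairs of children of a family of pairs of nodes. -/
lemma pairLaw_sum_children_lt (p : Fin M → I) (e : ℤ) {n : ℕ} {d : ℤ}
    {P : Finset (MNode M × MNode M)} (hP : P ⊆ pairs M n d) {N η : ℝ} (hN : 0 ≤ N) (hη : 0 < η)
    (h : N ≤ P.card ∨ rate p e = 0) :
    pairLaw p {ω | ∑ q ∈ P, children e q ω < N * (rate p e - η)} ≤
      ENNReal.ofReal (Real.exp (-(η ^ 2 / (2 * variance M) * N))) := by
  -- In this case the threshold is at most `0` and the event is empty. This also settles `rate p e =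
  -- 0`, where nothing is known about the size of `P`.
  by_cases hr : rate p e - η ≤ 0
  · have : {ω | ∑ q ∈ P, children e q ω < N * (rate p e - η)} = ∅ := by
      ext ω
      simp only [Set.mem_ofPred_eq, Set.mem_empty_iff_false, iff_false, not_lt]
      exact (mul_nonpos_of_nonneg_of_nonpos hN hr).trans
        (Finset.sum_nonneg fun q _ => children_nonneg e q ω)
    simp [this]
  · push Not at hr
    have hNP : N ≤ P.card := h.resolve_right (by linarith)
    have hsub := (hasSubgaussianMGF_sum_children p e P hP).neg.measure_ge_le
      (ε := P.card * η) (by positivity)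
    have hle : pairLaw p {ω | ∑ q ∈ P, children e q ω < N * (rate p e - η)} ≤
        pairLaw p {ω | P.card * η ≤ (-fun ω => ∑ q ∈ P, (children e q ω - rate p e)) ω} := by
      refine measure_mono fun ω hω => ?_
      simp only [Set.mem_ofPred_eq, Pi.neg_apply, Finset.sum_sub_distrib, Finset.sum_const,
        nsmul_eq_mul] at hω ⊢
      nlinarith [mul_le_mul_of_nonneg_right hNP hr.le]
    refine hle.trans ?_
    rw [← ENNReal.ofReal_toReal (measure_ne_top _ _)]
    refine ENNReal.ofReal_le_ofReal (hsub.trans (Real.exp_le_exp.2 ?_))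
    rw [neg_div, neg_le_neg_iff]
    push_cast
    have hv : (P.card * η) ^ 2 / (2 * (P.card * (variance M : ℝ))) =
        η ^ 2 / (2 * variance M) * P.card := by
      rcases eq_or_ne (P.card : ℝ) 0 with h0 | h0
      · simp [h0]
      · field_simp
    rw [hv]
    gcongr

/-- The number of pairs of selected nodes of level `n` with difference `d`. -/
noncomputable def count (n : ℕ) (d : ℤ) (ω : MLabeling M × MLabeling M) : ℝ :=
  corr (ind ω.1) (ind ω.2) n d

open Classical in
/-- The pairs of nodes of level `n` with difference `d` in a given pair of sets of nodes. -/
noncomputable def pairsIn (n : ℕ) (d : ℤ) (k : Finset (MNode M) × Finset (MNode M)) :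
    Finset (MNode M × MNode M) :=
  (pairs M n d).filter fun q => q.1 ∈ k.1 ∧ q.2 ∈ k.2

lemma pairsIn_subset (n : ℕ) (d : ℤ) (k : Finset (MNode M) × Finset (MNode M)) :
    pairsIn n d k ⊆ pairs M n d := Finset.filter_subset _ _

lemma sum_pairs_ind (n : ℕ) (d : ℤ) (ω : MLabeling M × MLabeling M)
    (F : MNode M × MNode M → ℝ) :
    ∑ q ∈ pairs M n d, ind ω.1 q.1 * ind ω.2 q.2 * F q =
      ∑ q ∈ pairsIn n d (selectedPair n ω), F q := by
  classical
  rw [pairsIn, Finset.sum_filter]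
  refine Finset.sum_congr rfl fun q hq => ?_
  have hq' := (mem_pairs.1 hq).1
  rw [ind_eq ω.1 hq'.1, ind_eq ω.2 hq'.2]
  simp only [selectedPair, Set.Finite.mem_toFinset]
  by_cases h1 : q.1 ∈ selected ω.1 n <;> by_cases h2 : q.2 ∈ selected ω.2 n <;> simp [h1, h2]

lemma count_eq_card (n : ℕ) (d : ℤ) (ω : MLabeling M × MLabeling M) :
    count n d ω = (pairsIn n d (selectedPair n ω)).card := by
  have := sum_pairs_ind n d ω fun _ => 1
  simpa [count, corr] using this

lemma count_succ (n : ℕ) (c : ℤ) {k : ℕ} (hk : k ≤ M) (ω : MLabeling M × MLabeling M) :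
    count (n + 1) (c * M + k) ω =
      ∑ q ∈ pairsIn n c (selectedPair n ω), children k q ω +
      ∑ q ∈ pairsIn n (c + 1) (selectedPair n ω), children (k - M) q ω := by
  rw [count, corr_succ (ind_concat ω.1) (ind_concat ω.2) n c hk, ← sum_pairs_ind, ← sum_pairs_ind]
  rfl

lemma meets_of_count_pos {n : ℕ} {d : ℤ} {ω : MLabeling M × MLabeling M} (h : 0 < count n d ω) :
    Meets ω.1 ω.2 n d := by
  rw [count_eq_card, Nat.cast_pos, Finset.card_pos] at h
  obtain ⟨q, hq⟩ := h
  have h1 := Finset.mem_filter.1 hq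
  exact ⟨q.1, (Set.Finite.mem_toFinset _).1 h1.2.1, q.2, (Set.Finite.mem_toFinset _).1 h1.2.2,
    (mem_pairs.1 h1.1).2⟩

lemma measurableSet_le_count (n : ℕ) (d : ℤ) (N : ℝ) :
    MeasurableSet[sigmaOf {a | len a ≤ n}] {ω : MLabeling M × MLabeling M | N ≤ count n d ω} := by
  have : {ω : MLabeling M × MLabeling M | N ≤ count n d ω} =
      ⋃ (k : Finset (MNode M) × Finset (MNode M)) (_ : N ≤ (pairsIn n d k).card),
        selectedPair n ⁻¹' {k} := by
    ext ω
    simp [count_eq_card]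
  rw [this]
  exact .iUnion fun k => .iUnion fun _ => measurableSet_selectedPair n k

lemma rate_neg_eq_zero (p : Fin M → I) : rate p (-M) = 0 := by
  refine Finset.sum_eq_zero fun r hr => ?_
  have h1 := mem_digits.1 hr
  have h2 := r.1.isLt
  omega

/-- If all differences in a range are attained `N` times on level `n`, then on the next level they
are attained `A * N` times, with high probability. -/
lemma pairLaw_exists_count_lt (p : Fin M → I) (hM : 0 < M) {A η : ℝ} (hη : 0 < η)
    (hA : ∀ k < M, A + 2 * η ≤ autocorr p k) (n L : ℕ) {N : ℝ} (hN : 0 ≤ N)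
    {C : Set (MLabeling M × MLabeling M)} (hC : MeasurableSet[sigmaOf {a | len a ≤ n}] C)
    (hCN : ∀ ω ∈ C, ∀ d ≤ L, N ≤ count n d ω) :
    pairLaw p (C ∩ {ω | ∃ d ≤ L * M, count (n + 1) d ω < N * A}) ≤
      ((L * M + 1 : ℕ) * (2 * ENNReal.ofReal (Real.exp (-(η ^ 2 / (2 * variance M) * N))))) *
        pairLaw p C := by
  set δ := ENNReal.ofReal (Real.exp (-(η ^ 2 / (2 * variance M) * N))) with hδ
  let bad : Finset (MNode M) × Finset (MNode M) → ℤ → ℤ → Set (MLabeling M × MLabeling M) :=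
    fun k c e => {ω | ∑ q ∈ pairsIn n c k, children e q ω < N * (rate p e - η)}
  -- The parents of `d` have difference `d / M` or `d / M + 1`. If neither contribution is bad, the
  -- total is at least `N * (γ (d % M) - 2 * η) ≥ N * A`.
  let E : Finset (MNode M) × Finset (MNode M) → Set (MLabeling M × MLabeling M) := fun k =>
    ⋃ d ∈ Finset.range (L * M + 1), (bad k (d / M : ℕ) (d % M : ℕ) ∪
      bad k ((d / M : ℕ) + 1) ((d % M : ℕ) - M))
  have hbadm : ∀ k c e, MeasurableSet[sigmaOf {a | n < len a}] (bad k c e) := by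
    intro k c e
    have hm : Measurable[sigmaOf {a | n < len a}]
        fun ω : MLabeling M × MLabeling M => ∑ q ∈ pairsIn n c k, children e q ω := by
      refine Finset.measurable_sum _ fun q hq => measurable_children e ?_
      have hq' := (mem_pairs.1 (pairsIn_subset _ _ _ hq)).1
      rintro a (⟨i, rfl⟩ | ⟨i, rfl⟩) <;> simp [len, hq']
    exact hm measurableSet_Iio
  refine measure_inter_le_of_indep (sigmaOf_le _) (indep_sigmaOf p (disjoint_len n))
    (measurableSet_selectedPair n) hC (E := E) ?_ ?_ ?_
  · intro k
    exact Finset.measurableSet_biUnion _ fun d _ =>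
      @MeasurableSet.union _ (sigmaOf _) _ _ (hbadm _ _ _) (hbadm _ _ _)
  · intro ω hω
    have hcard : ∀ d : ℕ, d ≤ L → N ≤ (pairsIn n d (selectedPair n ω)).card := by
      intro d hd
      rw [← count_eq_card]
      exact hCN ω hω d hd
    calc pairLaw p (E (selectedPair n ω)) ≤ ∑ d ∈ Finset.range (L * M + 1), _ :=
          measure_biUnion_finset_le _ _
      _ ≤ ∑ d ∈ Finset.range (L * M + 1), 2 * δ := by
        refine Finset.sum_le_sum fun d hd => (measure_union_le _ _).trans ?_
        rw [two_mul]
        have hd' : d ≤ L * M := Nat.lt_succ_iff.1 (Finset.mem_range.1 hd)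
        have hdM : d / M ≤ L := Nat.div_le_of_le_mul (by rwa [mul_comm])
        refine add_le_add ?_ ?_
        · exact pairLaw_sum_children_lt p _ (pairsIn_subset _ _ _) hN hη (Or.inl (hcard _ hdM))
        · refine pairLaw_sum_children_lt p _ (pairsIn_subset _ _ _) hN hη ?_
          rcases hdM.lt_or_eq with h | h
          · left
            exact_mod_cast hcard _ h
          -- Here `d = L * M`, and `d / M + 1` leaves the controlled range; but its digit difference
          -- would be `-M`, which never occurs.
          · right
            have h0 : d % M = 0 := by
              have := Nat.div_add_mod d M
              rw [h, mul_comm] at this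
              omega
            rw [h0, Nat.cast_zero, zero_sub, rate_neg_eq_zero]
      _ = _ := by rw [Finset.sum_const, Finset.card_range, nsmul_eq_mul]
  · rintro ω - ⟨d, hd, hlt⟩
    refine Set.mem_iUnion₂.2 ⟨d, Finset.mem_range.2 (Nat.lt_succ_of_le hd), ?_⟩
    have hdk : (d : ℤ) = (d / M : ℕ) * M + (d % M : ℕ) := by
      exact_mod_cast (Nat.div_add_mod' d M).symm
    have hmod := Nat.mod_lt d hM
    rw [hdk, count_succ n _ hmod.le] at hlt
    by_contra hcon
    simp only [bad, Set.mem_union, Set.mem_ofPred_eq, not_or, not_lt] at hcon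
    have h1 := hA _ hmod
    rw [← rate_add_rate p hmod.le] at h1
    nlinarith [hcon.1, hcon.2, mul_le_mul_of_nonneg_left h1 hN]

/-! ### Summability of the failure probabilities. -/

lemma exists_sum_exp_le (M : ℕ) {A κ : ℝ} (hA : 1 < A) (hκ : 0 < κ) :
    ∃ N : ℝ, 0 < N ∧ ∀ j : ℕ, ∑ i ∈ Finset.range j,
      ((M ^ i * M + 1 : ℕ) * (2 * Real.exp (-(κ * (N * A ^ i))))) ≤ 1 / 2 := by
  set a : ℕ → ℝ := fun i => (M ^ i * M + 1 : ℕ) * (2 * Real.exp (-(κ * A ^ i))) with ha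
  have ha0 : ∀ i, 0 ≤ a i := fun i => by positivity
  have hsum : Summable a := by
    -- With `A ^ l ≥ 2 * (M + 1)`, the bound `exp x ≥ x ^ l / l!` at `x = κ * A ^ i` beats the
    -- factor `M ^ i` and leaves a geometric series of ratio `1 / 2`.
    obtain ⟨l, hl⟩ := ((tendsto_pow_atTop_atTop_of_one_lt hA).eventually_ge_atTop
      (2 * (M + 1 : ℝ))).exists
    refine Summable.of_nonneg_of_le ha0 (fun i => ?_)
      (summable_geometric_two.mul_left (4 * (M + 1 : ℝ) * (l.factorial / κ ^ l)))
    have hx : 0 < κ * A ^ i := by positivity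
    have h1 := Real.pow_div_factorial_le_exp (κ * A ^ i) hx.le l
    have hA2 : (2 * (M + 1 : ℝ)) ^ i ≤ (A ^ i) ^ l := by
      rw [← pow_mul, mul_comm i, pow_mul]
      exact pow_le_pow_left₀ (by positivity) hl i
    have h2 : Real.exp (-(κ * A ^ i)) ≤ l.factorial / κ ^ l * (1 / (2 * (M + 1 : ℝ)) ^ i) := by
      rw [Real.exp_neg, div_mul_div_comm, mul_one]
      rw [inv_le_comm₀ (Real.exp_pos _) (by positivity), inv_div]
      refine le_trans ?_ h1
      rw [mul_pow κ]
      gcongr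
    have h3 : ((M ^ i * M + 1 : ℕ) : ℝ) ≤ 2 * ((M + 1 : ℝ) * (M + 1) ^ i) := by
      push_cast
      have h4 : (M : ℝ) ^ i ≤ (M + 1 : ℝ) ^ i := by gcongr; linarith
      have h5 : (1 : ℝ) ≤ (M + 1 : ℝ) ^ i := one_le_pow₀ (by linarith [Nat.cast_nonneg (α := ℝ) M])
      nlinarith [Nat.cast_nonneg (α := ℝ) M]
    calc a i ≤ (2 * ((M + 1 : ℝ) * (M + 1) ^ i)) *
          (2 * (l.factorial / κ ^ l * (1 / (2 * (M + 1 : ℝ)) ^ i))) := by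
          simp only [ha]; gcongr
      _ = _ := by
          rw [mul_pow, div_pow, one_pow]
          field_simp
          ring
  have hlim : Tendsto (fun T : ℝ => Real.exp (-(κ * T)) * ∑' i, a i) atTop (𝓝 0) := by
    have : Tendsto (fun T : ℝ => Real.exp (-(κ * T))) atTop (𝓝 0) :=
      Real.tendsto_exp_neg_atTop_nhds_zero.comp (tendsto_id.const_mul_atTop hκ)
    simpa using this.mul_const (∑' i, a i)
  obtain ⟨T, hT, hT0⟩ := ((hlim.eventually_le_const (by norm_num : (0 : ℝ) < 1 / 2)).and
    (eventually_ge_atTop 0)).exists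
  -- As `A ^ i ≥ 1`, the extra `T` contributes a factor `exp (-(κ * T))` to every term, which makes
  -- the sum small.
  refine ⟨1 + T, by linarith, fun j => ?_⟩
  calc _ ≤ ∑ i ∈ Finset.range j, Real.exp (-(κ * T)) * a i := by
        refine Finset.sum_le_sum fun i _ => ?_
        have h1 : (1 : ℝ) ≤ A ^ i := one_le_pow₀ hA.le
        have h2 : Real.exp (-(κ * ((1 + T) * A ^ i))) ≤
            Real.exp (-(κ * T)) * Real.exp (-(κ * A ^ i)) := by
          rw [← Real.exp_add, Real.exp_le_exp]
          nlinarith [mul_le_mul_of_nonneg_left h1 (mul_nonneg hκ.le hT0)]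
        simp only [ha]
        calc _ ≤ ((M ^ i * M + 1 : ℕ) : ℝ) *
              (2 * (Real.exp (-(κ * T)) * Real.exp (-(κ * A ^ i)))) := by gcongr
          _ = _ := by ring
    _ = Real.exp (-(κ * T)) * ∑ i ∈ Finset.range j, a i := by rw [Finset.mul_sum]
    _ ≤ Real.exp (-(κ * T)) * ∑' i, a i := by
        gcongr
        exact hsum.sum_le_tsum _ fun i _ => ha0 i
    _ ≤ _ := hT

/-! ### Starting the growth and letting it run forever. -/

lemma corr_selProb_zero (p : Fin M → I) (n : ℕ) :
    corr (selProb p) (selProb p) n 0 = autocorr p 0 ^ n := by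
  induction n with
  | zero =>
    have : pairs M 0 0 = {([], [])} := by
      ext ⟨s, t⟩
      simp only [mem_pairs, List.length_eq_zero_iff, Finset.mem_singleton, Prod.mk.injEq]
      constructor
      · exact fun h => h.1
      · rintro ⟨rfl, rfl⟩
        simp
    simp [corr, this, selProb]
  | succ n ih =>
    have h := corr_selProb_succ p n 0 (k := 0) (Nat.zero_le _)
    have h2 := rate_add_rate p (k := 0) (Nat.zero_le _)
    simp only [Nat.cast_zero, zero_mul, zero_add, zero_sub, rate_neg_eq_zero, add_zero] at h h2
    rw [h, h2, ih, pow_succ']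

/-- At most one pair of digits has difference `1 - M`, so that pair accounts for at most `1` of `γ 1
> 1`. -/
lemma rate_one_pos (p : Fin M → I) (hM : 2 ≤ M) (h : 1 < autocorr p 1) : 0 < rate p 1 := by
  have h1 := rate_add_rate p (k := 1) (by omega)
  have h2 : rate p ((1 : ℕ) - M) ≤ 1 := by
    have hcard : (digits M ((1 : ℕ) - M)).card ≤ 1 := by
      refine Finset.card_le_one.2 fun a ha b hb => ?_
      rw [mem_digits] at ha hb
      have := a.1.isLt
      have := b.1.isLt
      refine Prod.ext (Fin.ext ?_) (Fin.ext ?_) <;> omega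
    calc rate p ((1 : ℕ) - M) ≤ ∑ r ∈ digits M ((1 : ℕ) - M), (1 : ℝ) :=
          Finset.sum_le_sum fun r _ => mul_le_one₀ (p _).2.2 (p _).2.1 (p _).2.2
      _ = ((digits M ((1 : ℕ) - M)).card : ℝ) := by simp
      _ ≤ 1 := by exact_mod_cast hcard
  push_cast at h1 h2
  linarith

/-- Difference `0` reproduces itself at rate `γ 0 > 1`, and it feeds difference `1` at the positive
rate `rate p 1`. -/
lemma tendsto_corr_selProb (p : Fin M → I) (hM : 2 ≤ M) (h0 : 1 < autocorr p 0)
    (h1 : 1 < autocorr p 1) {d : ℕ} (hd : d ≤ 1) :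
    Tendsto (fun n => corr (selProb p) (selProb p) n d) atTop atTop := by
  interval_cases d
  · simp only [Nat.cast_zero, corr_selProb_zero]
    exact tendsto_pow_atTop_atTop_of_one_lt h0
  · rw [← tendsto_add_atTop_iff_nat 1]
    refine tendsto_atTop_mono (fun n => ?_)
      ((tendsto_pow_atTop_atTop_of_one_lt h0).const_mul_atTop (rate_one_pos p hM h1))
    have h := corr_selProb_succ p n 0 (k := 1) (by omega)
    have h2 : 0 ≤ rate p ((1 : ℕ) - M) * corr (selProb p) (selProb p) n (0 + 1) :=
      mul_nonneg (rate_nonneg _ _) (corr_nonneg (selProb_nonneg p) (selProb_nonneg p) _ _)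
    rw [corr_selProb_zero, zero_mul, zero_add] at h
    rw [h]
    push_cast at h2 ⊢
    linarith

/-- The nodes of level at most `n` that lie on a node of level `n` which has a positive
probability of being selected. -/
noncomputable def possibleNodes (p : Fin M → I) (n : ℕ) : Finset (MNode M) :=
  {s ∈ words M n | 0 < selProb p s}.biUnion ancestors

lemma prod_possibleNodes_pos (p : Fin M → I) (n : ℕ) :
    0 < ∏ t ∈ possibleNodes p n, (nodeProb p t : ℝ) := by
  refine Finset.prod_pos fun t ht => ?_
  obtain ⟨s, hs, hts⟩ := Finset.mem_biUnion.1 ht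
  have hs := (Finset.mem_filter.1 hs).2
  rw [← prod_ancestors] at hs
  exact lt_of_le_of_ne (nodeProb p t).2.1 fun h => hs.ne' (Finset.prod_eq_zero hts h.symm)

lemma selProb_le_one (p : Fin M → I) (s : MNode M) : selProb p s ≤ 1 := by
  rw [← prod_ancestors]
  exact Finset.prod_le_one (fun t _ => (nodeProb p t).2.1) fun t _ => (nodeProb p t).2.2

lemma selProb_le_ind (p : Fin M → I) {n : ℕ} {X : MLabeling M}
    (hX : ∀ t ∈ possibleNodes p n, X t = true) {s : MNode M} (hs : s.length = n) :
    selProb p s ≤ ind X s := by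
  rcases (selProb_nonneg p s).eq_or_lt with h | h
  · rw [← h]; exact ind_nonneg _ _
  · rw [ind, if_pos]
    · exact selProb_le_one p s
    · exact fun t ht => hX t (Finset.mem_biUnion.2
        ⟨s, Finset.mem_filter.2 ⟨mem_words.2 hs, h⟩, ht⟩)

/-- With positive probability the finitely many labels that matter are all `1`. Then every node of
positive `selProb` is selected, and `selProb ≤ ind` bounds all differences at once. -/
lemma pairLaw_corr_selProb_le_count_pos (p : Fin M → I) (n : ℕ) :
    0 < pairLaw p {ω | ∀ d, corr (selProb p) (selProb p) n d ≤ count n d ω} := by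
  set B : Set (MLabeling M) := {X | ∀ t ∈ possibleNodes p n, X t = true}
  have hB : 0 < labelLaw p B := by
    rw [labelLaw_box]
    exact ENNReal.ofReal_pos.2 (prod_possibleNodes_pos p n)
  calc 0 < labelLaw p B * labelLaw p B := ENNReal.mul_pos hB.ne' hB.ne'
    _ = pairLaw p (B ×ˢ B) := (Measure.prod_prod _ _).symm
    _ ≤ _ := by
      refine measure_mono fun ω hω d => Finset.sum_le_sum fun q hq => ?_
      have hq' := (mem_pairs.1 hq).1
      exact mul_le_mul (selProb_le_ind p hω.1 hq'.1) (selProb_le_ind p hω.2 hq'.2)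
        (selProb_nonneg p _) (ind_nonneg _ _)

/-- All differences in `[0, M ^ i]` are attained `N * A ^ i` times on level `n + i`, for `i ≤ j`. -/
def growth (M n : ℕ) (N A : ℝ) (j : ℕ) : Set (MLabeling M × MLabeling M) :=
  {ω | ∀ i ≤ j, ∀ d : ℕ, d ≤ M ^ i → N * A ^ i ≤ count (n + i) d ω}

lemma measurableSet_growth (n : ℕ) (N A : ℝ) (j : ℕ) :
    MeasurableSet[sigmaOf {a | len a ≤ n + j}] (growth M n N A j) := by
  have : growth M n N A j = ⋂ (i : ℕ) (_ : i ≤ j) (d : ℕ) (_ : d ≤ M ^ i),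
      {ω | N * A ^ i ≤ count (n + i) d ω} := by
    ext ω; simp [growth]
  rw [this]
  refine .iInter fun i => .iInter fun hi => .iInter fun d => .iInter fun _ => ?_
  refine sigmaOf_mono (fun a ha => ?_) _ (measurableSet_le_count (n + i) d _)
  exact le_trans (show len a ≤ n + i from ha) (by omega)

lemma growth_antitone (n : ℕ) (N A : ℝ) : Antitone (growth M n N A) :=
  fun _ _ h _ hω i hi => hω i (hi.trans h)

lemma covers_of_forall_growth {n : ℕ} {N A : ℝ} (hN : 0 < N) (hA : 0 < A)
    {ω : MLabeling M × MLabeling M} (h : ∀ j, ω ∈ growth M n N A j) : Covers ω.1 ω.2 n 0 := by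
  intro m d h1 h2
  rw [zero_mul] at h1
  rw [zero_add, one_mul] at h2
  obtain ⟨d, rfl⟩ := Int.eq_ofNat_of_zero_le h1
  have hle : d ≤ M ^ m := by exact_mod_cast h2.le
  exact meets_of_count_pos ((by positivity : 0 < N * A ^ m).trans_le (h m m le_rfl d hle))

/-- Each step loses at most its failure bound times the probability of the current event, hence
times that of the initial one; so the relative losses simply add up. -/
lemma pairLaw_growth_ge (p : Fin M → I) (hM : 0 < M) {A η : ℝ} (hη : 0 < η) (hA0 : 0 < A)
    (hA : ∀ k < M, A + 2 * η ≤ autocorr p k) (n : ℕ) {N : ℝ} (hN : 0 ≤ N) (j : ℕ) :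
    (pairLaw p).real (growth M n N A 0) * (1 - ∑ i ∈ Finset.range j,
      ((M ^ i * M + 1 : ℕ) * (2 * Real.exp (-(η ^ 2 / (2 * variance M) * (N * A ^ i)))))) ≤
      (pairLaw p).real (growth M n N A j) := by
  induction j with
  | zero => simp
  | succ j ih =>
    set δ := (M ^ j * M + 1 : ℕ) * (2 * Real.exp (-(η ^ 2 / (2 * variance M) * (N * A ^ j)))) with hδ
    have hδ0 : 0 ≤ δ := by positivity
    have hstep : (pairLaw p).real (growth M n N A j ∩
        {ω | ∃ d ≤ M ^ j * M, count (n + j + 1) d ω < N * A ^ j * A}) ≤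
          δ * (pairLaw p).real (growth M n N A 0) := by
      have h := pairLaw_exists_count_lt p hM hη hA (n + j) (M ^ j) (N := N * A ^ j) (by positivity)
        (measurableSet_growth n N A j) fun ω hω d hd => hω j le_rfl d hd
      have h2 := ENNReal.toReal_mono (by finiteness) h
      simp only [ENNReal.toReal_mul, ENNReal.toReal_natCast, ENNReal.toReal_ofNat,
        ENNReal.toReal_ofReal (Real.exp_nonneg _)] at h2
      refine le_trans h2 (mul_le_mul_of_nonneg_left ?_ hδ0)
      exact measureReal_mono (growth_antitone n N A (Nat.zero_le j))
    have hcover : growth M n N A j ⊆ growth M n N A (j + 1) ∪ (growth M n N A j ∩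
        {ω | ∃ d ≤ M ^ j * M, count (n + j + 1) d ω < N * A ^ j * A}) := by
      intro ω hω
      by_cases hb : ∃ d ≤ M ^ j * M, count (n + j + 1) d ω < N * A ^ j * A
      · exact Or.inr ⟨hω, hb⟩
      · left
        push Not at hb
        intro i hi d hd
        rcases Nat.le_succ_iff.1 hi with hi | rfl
        · exact hω i hi d hd
        · have := hb d (by rwa [← pow_succ])
          rwa [pow_succ, ← mul_assoc]
    have hsum := (measureReal_mono (μ := pairLaw p) hcover).trans (measureReal_union_le _ _)
    rw [Finset.sum_range_succ]
    nlinarith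

theorem pairLaw_covers_ne_zero (p : Fin M → I) (hM : 2 ≤ M) (hp : ∀ k < M, 1 < autocorr p k) :
    pairLaw p {ω | ∃ n c, Covers ω.1 ω.2 n c} ≠ 0 := by
  obtain ⟨B, hB1, hB⟩ : ∃ B : ℝ, 1 < B ∧ ∀ k < M, B ≤ autocorr p k := by
    have hne : (Finset.range M).Nonempty := ⟨0, Finset.mem_range.2 (by omega)⟩
    obtain ⟨k, hk, hmin⟩ := Finset.exists_min_image (Finset.range M) (autocorr p) hne
    exact ⟨autocorr p k, hp k (Finset.mem_range.1 hk), fun l hl => hmin l (Finset.mem_range.2 hl)⟩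
  -- Chosen so that `A` is midway between `1` and `B`, and `A + 2 * η = B`.
  set η := (B - 1) / 4 with hη
  set A := (B + 1) / 2 with hA
  have hη0 : 0 < η := by rw [hη]; linarith
  have hA1 : 1 < A := by rw [hA]; linarith
  have hAη : ∀ k < M, A + 2 * η ≤ autocorr p k := fun k hk => by
    have := hB k hk
    rw [hη, hA]; linarith
  have hv : (0 : ℝ) < variance M := variance_pos (by omega)
  obtain ⟨N, hN, hsum⟩ := exists_sum_exp_le M hA1 (by positivity : 0 < η ^ 2 / (2 * variance M))
  obtain ⟨n, hn0, hn1⟩ := (((tendsto_corr_selProb p hM (hp 0 (by omega)) (hp 1 (by omega))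
    zero_le_one).eventually_ge_atTop N).and ((tendsto_corr_selProb p hM (hp 0 (by omega))
      (hp 1 (by omega)) le_rfl).eventually_ge_atTop N)).exists
  have hinit : 0 < (pairLaw p).real (growth M n N A 0) := by
    refine ENNReal.toReal_pos (ne_of_gt ?_) (measure_ne_top _ _)
    refine (pairLaw_corr_selProb_le_count_pos p n).trans_le (measure_mono fun ω hω => ?_)
    intro i hi d hd
    obtain rfl : i = 0 := by omega
    rw [pow_zero] at hd
    rw [pow_zero, mul_one, add_zero]
    refine le_trans ?_ (hω d)
    interval_cases d
    · exact hn0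
    · exact hn1
  have hge : ∀ j, (pairLaw p).real (growth M n N A 0) / 2 ≤ (pairLaw p).real (growth M n N A j) := by
    intro j
    refine le_trans ?_ (pairLaw_growth_ge p (by omega) hη0 (by linarith) hAη n hN.le j)
    rw [div_eq_mul_one_div]
    gcongr
    linarith [hsum j]
  have hlim := tendsto_measure_iInter_atTop (μ := pairLaw p) (s := growth M n N A)
    (fun j => (sigmaOf_le _ _ (measurableSet_growth n N A j)).nullMeasurableSet)
    (growth_antitone n N A) ⟨0, measure_ne_top _ _⟩
  have hpos : ENNReal.ofReal ((pairLaw p).real (growth M n N A 0) / 2) ≤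
      pairLaw p (⋂ j, growth M n N A j) := by
    refine ge_of_tendsto' hlim fun j => ?_
    exact ENNReal.ofReal_le_of_le_toReal (hge j)
  refine ne_of_gt (lt_of_lt_of_le (ENNReal.ofReal_pos.2 (by positivity)) (hpos.trans
    (measure_mono fun ω hω => ?_)))
  exact ⟨n, 0, covers_of_forall_growth hN (by linarith) fun j => Set.mem_iInter.1 hω j⟩

/-! ### Conclusion of part (a) under the conditional law. -/

lemma nonempty_subset_survival :
    {ω : MLabeling M × MLabeling M | (mCantorSet ω.1).Nonempty ∧ (mCantorSet ω.2).Nonempty} ⊆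
      survival M := by
  have key : ∀ X : MLabeling M, (mCantorSet X).Nonempty → ∀ n, (selected X n).Nonempty := by
    rintro X ⟨x, hx⟩ n
    have h := mCantorApprox_antitone X (Nat.le_succ n)
      (Set.mem_iInter₂.1 hx (n + 1) (Nat.le_add_left _ _))
    obtain ⟨s, hs, -⟩ := Set.mem_iUnion₂.1 h
    exact ⟨s, hs⟩
  exact fun ω hω n => ⟨key _ hω.1 n, key _ hω.2 n⟩

theorem ae_containsInterval (hM : 2 ≤ M) (p : Fin M → I) (hp : ∀ k < M, 1 < autocorr p k) :
    ∀ᵐ ω ∂(condPairLaw p), ContainsInterval (mCantorSet ω.2 - mCantorSet ω.1) := by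
  have h := ae_survival_covers p (pairLaw_covers_ne_zero p hM hp)
  have h2 := ae_mono (Measure.restrict_mono nonempty_subset_survival le_rfl) h
  refine Measure.ae_smul_measure ?_ _
  filter_upwards [h2] with ω hω
  obtain ⟨n, c, hc⟩ := hω
  exact hc.containsInterval hM

end MAdic

theorem theorem1 (M : ℕ) (hM : 2 ≤ M) (p : Fin M → I) (hp : 1 < ∑ k, (p k : ℝ)) :
    ((∀ k : ℕ, k < M → 1 < autocorr p k) →
      ∀ᵐ ω ∂(condPairLaw p), ContainsInterval (mCantorSet ω.2 - mCantorSet ω.1)) ∧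
    ((∃ k : ℕ, k < M ∧ autocorr p k < 1 ∧ autocorr p (k + 1) < 1) →
      ∀ᵐ ω ∂(condPairLaw p), ¬ ContainsInterval (mCantorSet ω.2 - mCantorSet ω.1)) := by
  refine ⟨MAdic.ae_containsInterval hM p, ?_⟩
  rintro ⟨k, hk, h1, h2⟩
  exact cond_absolutelyContinuous.ae_le (MAdic.ae_not_containsInterval hM p hk h1 h2)
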